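/- \textbf{Setting ($N=1$).} Let $H=\mathbb C$ with $(1,1)=1$. Consider formal power series $F\in\mathbb C[[t_0,t_1,t_2,\dots]]$, put $q_i=t_i-\delta_{i,1}$, $\mathbf q(z)=\sum_{i\ge 0}q_iz^i$ and $\partial_i=\partial/\partial t_i=\partial/\partial q_i$. Let $GW_0$ be the set of all $F$ satisfying the dilaton equation $\sum_{i\ge0}q_i\partial_iF=2F$, the string equation $\sum_{i\ge0}q_{i+1}\partial_iF=-\tfrac12q_0^2$, and the topological recursion relations $\partial_{k+1}\partial_l\partial_mF=(\partial_k\partial_0F)(\partial_0\partial_l\partial_mF)$ for all $k,l,m\ge0$. Let $G_-$ be the group of series $S(z)=1+S_1z^{-1}+S_2z^{-2}+\cdots$, $S_i\in\mathbb C$, with $S(-z)S(z)=1$. For $F\in\mathbb C[[t_0,t_1,\dots]]$ let $$\mathcal L_F=\Big\{\sum_{i\ge0}q_iz^i+\sum_{i\ge0}p_i(-z)^{-i-1}\;:\;p_i=\frac{\partial F}{\partial q_i}(\mathbf q)\Big\}$$ be the graph of $dF$, as a formal cone near $\mathbf q(z)=-z$: its points are Laurent series in $z^{-1}$ with coefficients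 in $R=\mathbb C[[x_0,x_1,\dots]]$, for which all $t_i=q_i+\delta_{i,1}\in R$ have zero constant term. The group $G_-$ acts on Laurent series by multiplication, and an element $S\in G_-$ with $S_1=0$ takes $F\in GW_0$ to the $F'\in GW_0$ with $S\,\mathcal L_F=\mathcal L_{F'}$. Let $F_0^{pt}=\sum_{n\ge3}\frac1{n!}\sum_{i_1,\dots,i_n\ge0}t_{i_1}\cdots t_{i_n}\int_{\overline{\mathcal M}_{0,n}}\psi_1^{i_1}\cdots\psi_n^{i_n}$, where the integral is $\frac{(n-3)!}{i_1!\cdots i_n!}$ if $i_1+\dots+i_n=n-3$ and $0$ otherwise. \textbf{Corollary ($G_-$ acts transitively on $GW_0$ for $N=1$).} \begin{enumerate} \item For every $S\in G_-$ with $S_1=0$ and every $F\in GW_0$ there is exactly one $F'\in GW_0$ with $S\,\mathcal L_F=\mathcal L_{F'}$; that is, the action is well defined on $GW_0$. \item $F_0^{pt}\in GW_0$, and for every $F\in GW_0$ there are $a_3,a_5,a_7,\dots\in\mathbb C$ such that $S=\exp(a_3z^{-3}+a_5z^{-5}+\cdots)$ lies in $G_-$ and takes $F_0^{pt}$ to $F$.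 \item More generally, for all $F,F'\in GW_0$ there is an element $S=\exp(a_3z^{-3}+a_5z^{-5}+\cdots)$ of $G_-$ that takes $F$ to $F'$. \end{enumerate} -/

import Mathlib

open scoped PowerSeries

namespace GenusZero

noncomputable section

/-- Formal functions `F(t₀, t₁, t₂, …)` for `H = ℂ`, `(1, 1) = 1`. Arbitrary (possibly infinite)
combinations of monomials in the `tᵢ` are allowed. -/
abbrev Potential : Type := MvPowerSeries ℕ ℂ

/-- The partial derivative `∂ᵢ = ∂/∂tᵢ = ∂/∂qᵢ`. -/
def pd (i : ℕ) (F : Potential) : Potential := MvPowerSeries.pderiv ℂ i F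

/-- The dilaton shifted variables `qᵢ = tᵢ - δ_{i,1}`. -/
def q (i : ℕ) : Potential := MvPowerSeries.X i - if i = 1 then 1 else 0

/-- In a sum `∑ᵢ q_{σ(i)} Gᵢ` every monomial has only finitely many contributions, so that the
coefficientwise sums in the dilaton and string equations are meaningful. -/
theorem finite_support_coeff_q_mul (σ : ℕ → ℕ) (hσ : Function.Injective σ) (G : ℕ → Potential)
    (m : ℕ →₀ ℕ) :
    (Function.support fun i => MvPowerSeries.coeff m (q (σ i) * G i)).Finite := by
  classical
  refine Set.Finite.subset
    ((m.support ∪ {1}).finite_toSet.preimage (f := σ) hσ.injOn) fun i hi => ?_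
  by_contra h
  simp only [Finset.coe_union, Finset.coe_singleton, Set.mem_preimage, Set.mem_union,
    Finset.mem_coe, Finsupp.mem_support_iff, Set.mem_singleton_iff, not_or, not_not] at h
  apply hi
  have hle : ¬ (Finsupp.single (σ i) 1 ≤ m) := by
    intro hle
    have := hle (σ i)
    simp [h.1] at this
  simp [q, h.2, MvPowerSeries.X, MvPowerSeries.coeff_monomial_mul, hle]

/-- The dilaton equation `∑_{i ≥ 0} qᵢ ∂ᵢ F = 2 F`. -/
def DilatonEq (F : Potential) : Prop :=
  ∀ m : ℕ →₀ ℕ,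
    ∑ᶠ i : ℕ, MvPowerSeries.coeff m (q i * pd i F) = MvPowerSeries.coeff m (2 * F)

/-- The string equation `∑_{i ≥ 0} q_{i+1} ∂ᵢ F = -(1/2) q₀²`. -/
def StringEq (F : Potential) : Prop :=
  ∀ m : ℕ →₀ ℕ,
    ∑ᶠ i : ℕ, MvPowerSeries.coeff m (q (i + 1) * pd i F) =
      -(1 / 2 : ℂ) * MvPowerSeries.coeff m (q 0 ^ 2)

/-- The genus zero topological recursion relations
`∂_{k+1} ∂_l ∂_m F = (∂_k ∂_0 F) (∂_0 ∂_l ∂_m F)`. -/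
def TRR (F : Potential) : Prop :=
  ∀ k l m : ℕ, pd (k + 1) (pd l (pd m F)) = pd k (pd 0 F) * pd 0 (pd l (pd m F))

/-- The space of rank one formal genus zero Gromov–Witten theories. -/
def GW₀ : Set Potential := {F | DilatonEq F ∧ StringEq F ∧ TRR F}

/-- The integral of `∏ᵢ ψ^{i}` over `M̄_{0,n}`, where `m i` of the `n = ∑ m i` marked points
carry the power `i` of their `ψ`-class: `(n-3)! / ∏ᵢ (i!)^{m i}` if `∑ i * m i = n - 3`,
and zero otherwise. -/
def psiIntegral (m : ℕ →₀ ℕ) : ℂ :=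
  if (m.sum fun i k => k * i) + 3 = m.degree then
    ((m.degree - 3).factorial : ℂ) / (m.prod fun i k => (i.factorial : ℂ) ^ k)
  else 0

/-- The genus zero potential of the point. The coefficient of `∏ tᵢ^{m i}` in
`∑_{n ≥ 3} (1/n!) ∑_{i₁,…,iₙ} t_{i₁} ⋯ t_{iₙ} ∫ ψ₁^{i₁} ⋯ ψₙ^{iₙ}` is the integral divided by
`∏ (m i)!`, as there are `n! / ∏ (m i)!` index sequences giving this monomial. -/
def pointPotential : Potential := fun m =>
  psiIntegral m / (m.prod fun _ k => (k.factorial : ℂ))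

/-- The lower-triangular group `G₋` for `H = ℂ`: series `S = 1 + S₁ z⁻¹ + S₂ z⁻² + ⋯` with
`S(-z) S(z) = 1`. The variable of the power series is `z⁻¹`. -/
def GMinus : Subgroup (ℂ⟦X⟧)ˣ where
  carrier := {S | PowerSeries.constantCoeff (S : ℂ⟦X⟧) = 1 ∧
    PowerSeries.evalNegHom (S : ℂ⟦X⟧) * (S : ℂ⟦X⟧) = 1}
  one_mem' := by simp
  mul_mem' := by
    rintro S T ⟨hS, hS'⟩ ⟨hT, hT'⟩
    refine ⟨by simp [hS, hT], ?_⟩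
    rw [Units.val_mul, map_mul, mul_mul_mul_comm, hS', hT', one_mul]
  inv_mem' := by
    rintro S ⟨hS, hS'⟩
    have h : (S : ℂ⟦X⟧) * ((S⁻¹ : (ℂ⟦X⟧)ˣ) : ℂ⟦X⟧) = 1 := Units.mul_inv S
    constructor
    · simpa [hS] using congrArg PowerSeries.constantCoeff h
    · have h2 := congrArg PowerSeries.evalNegHom h
      rw [map_mul, map_one] at h2
      calc _ = (PowerSeries.evalNegHom (S : ℂ⟦X⟧) * (S : ℂ⟦X⟧)) *
            (PowerSeries.evalNegHom ((S⁻¹ : (ℂ⟦X⟧)ˣ) : ℂ⟦X⟧) *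
              ((S⁻¹ : (ℂ⟦X⟧)ˣ) : ℂ⟦X⟧)) := by rw [hS', one_mul]
        _ = (PowerSeries.evalNegHom (S : ℂ⟦X⟧) *
              PowerSeries.evalNegHom ((S⁻¹ : (ℂ⟦X⟧)ˣ) : ℂ⟦X⟧)) *
            ((S : ℂ⟦X⟧) * ((S⁻¹ : (ℂ⟦X⟧)ˣ) : ℂ⟦X⟧)) := by ring
        _ = 1 := by rw [h, h2, one_mul]

/-- `exp(a₃ z⁻³ + a₅ z⁻⁵ + a₇ z⁻⁷ + ⋯)` as a power series in `z⁻¹`; only the values of `a` at odd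
numbers `≥ 3` are used. -/
def expOdd (a : ℕ → ℂ) : ℂ⟦X⟧ :=
  (PowerSeries.exp ℂ).subst
    (PowerSeries.mk fun n => if Odd n ∧ 3 ≤ n then a n else 0 : ℂ⟦X⟧)

/-- The coefficient ring of the formal points of the loop space. -/
abbrev PointRing : Type := MvPowerSeries ℕ ℂ

/-- The Laurent series in `z⁻¹` with coefficients in `PointRing` (formal points of
`ℂ((z⁻¹))`). The variable of the Hahn series is `z⁻¹`: the coefficient at `k` is that of
`z^{-k}`. -/
abbrev LoopSpace : Type := LaurentSeries PointRing

/-- The cone `𝓛_F`, the graph of `dF`: the set of all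
`∑ qᵢ zⁱ + ∑ pᵢ (-z)^{-i-1}` with `pᵢ = ∂F/∂qᵢ`. As `F` is a power series in `t`, that is, at
the point `q(z) = -z`, it is evaluated at the formal points `qᵢ = tᵢ - δ_{i,1}` where `tᵢ` has
no constant term (almost all `tᵢ` vanish, since `f` is a Laurent series in `z⁻¹`). -/
def cone (F : Potential) : Set LoopSpace :=
  {f | ∃ t : ℕ → PointRing,
    (∀ i, MvPowerSeries.constantCoeff (t i) = 0) ∧
    (∀ i : ℕ, f.coeff (-(i : ℤ)) = t i - if i = 1 then 1 else 0) ∧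
    (∀ i : ℕ, f.coeff ((i : ℤ) + 1) = (-1) ^ (i + 1) * MvPowerSeries.subst t (pd i F))}

/-- The image of a subset of the loop space under multiplication by `S(z)`. -/
def translate (S : ℂ⟦X⟧) (L : Set LoopSpace) : Set LoopSpace :=
  (fun f : LoopSpace =>
    HahnSeries.ofPowerSeries ℤ PointRing (PowerSeries.map (algebraMap ℂ PointRing) S) * f) '' L

end

end GenusZero

/-! For `S` in `GMinus` with `S₁ = 0`, put `T(z) = S(-z)`. The action of `S` can be written on
potentials: `F` goes to `F([T q]₊) + (1/2) ∑ W_{kl} q_k q_l`, where `∑ W_{kl} w^k z^l = (T(w) T(z) -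
1) / (w + z)` (`transform`). The condition `T(-z) T(z) = 1` makes this quotient a power series and
`W` symmetric, and `T₁ = 0` keeps the base point `q = -z` fixed. The dilaton equation survives
because both summands scale quadratically, the string equation because of the defining identity of
`W`, and the recursion relations because `W_{0k} = T_{k+1}` is the correction created by the change
of variables. The new graph is the translated cone (`IsCalibration.translate_cone`). A cone
determines `dF`, and the dilaton equation then recovers `F` (`eq_of_cone_subset`), which gives
uniqueness.

Transitivity rests on rigidity. At the origin the string equation expresses `∂₀` through lower
derivatives, so together with the recursion relations it forces `∂_k ∂_l F (0) = W_{kl}` for `T = 1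
+ ∑ (∂ₖF)(0) X^{k+2}`; the symmetry of mixed derivatives gives `T(-z) T(z) = 1`. Induction on the
degree shows that the linear terms determine all of `F` (`eq_of_constantCoeff_pd_eq`). The transform
of the point potential by `T` has the linear terms of `F`, so it is `F`.

For the point potential, dilaton and string are coefficient identities. The recursion relations
follow from string and homogeneity: their defects have positive degree and are killed inductively by
the string operator, hence vanish. Finally `S(-z) S(z) = 1` makes `log S` odd, and `S₁ = 0` removes
its `z⁻¹` term. -/

namespace MvPowerSeries

/-! ### Chain rule for substitution into multivariate power series -/

variable {σ τ R : Type*} [CommRing R]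

open WithPiTopology in
theorem continuous_pderiv [TopologicalSpace R] [ContinuousMul R] (i : σ) :
    Continuous (fun G : MvPowerSeries σ R => pderiv R i G) := by
  refine continuous_pi fun d => ?_
  have : (fun G : MvPowerSeries σ R => pderiv R i G d) =
      fun G => coeff (d + Finsupp.single i 1) G * ((d i : R) + 1) :=
    funext fun G => coeff_pderiv G d
  rw [this]
  exact (continuous_coeff R _).mul continuous_const

open WithPiTopology in
/-- Chain rule for a substitution only finitely many of whose terms depend on the variable. -/
theorem pderiv_subst {a : σ → MvPowerSeries τ R} (ha : HasSubst a) (k : τ) (s : Finset σ)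
    (hs : ∀ j ∉ s, pderiv R k (a j) = 0) (F : MvPowerSeries σ R) :
    pderiv R k (subst a F) = ∑ j ∈ s, pderiv R k (a j) * subst a (pderiv R j F) := by
  classical
  let : UniformSpace R := ⊥
  have hsub : Continuous (subst a : MvPowerSeries σ R → MvPowerSeries τ R) := continuous_subst ha
  -- Both sides are continuous in the series for the product topology over discrete coefficients,
  -- and polynomials are dense; this leaves an induction on polynomials.
  have key : (fun G : MvPowerSeries σ R => pderiv R k (subst a G)) =
      fun G => ∑ j ∈ s, pderiv R k (a j) * subst a (pderiv R j G) := by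
    refine MvPolynomial.toMvPowerSeries_isDenseInducing.dense.equalizer
      ((continuous_pderiv k).comp hsub) ?_ ?_
    · exact continuous_finsetSum _ fun j _ =>
        continuous_const.mul (hsub.comp (continuous_pderiv j))
    · funext p
      simp only [Function.comp_apply, subst_coe, pderiv_coe]
      induction p using MvPolynomial.induction_on with
      | C r => simp [MvPowerSeries.algebraMap_apply]
      | add p q hp hq => simp [hp, hq, mul_add, Finset.sum_add_distrib]
      | mul_X p i hp =>
        have h1 : ∀ j, MvPolynomial.aeval a (MvPolynomial.pderiv j (p * MvPolynomial.X i)) =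
            MvPolynomial.aeval a p * (if i = j then 1 else 0) +
              a i * MvPolynomial.aeval a (MvPolynomial.pderiv j p) := by
          intro j
          rw [MvPolynomial.pderiv_mul, map_add, map_mul, map_mul, MvPolynomial.aeval_X, add_comm,
            MvPolynomial.pderiv_X, Pi.single_apply]
          split_ifs <;> simp_all [mul_comm]
        have h2 : ∑ j ∈ s, pderiv R k (a j) * (if i = j then 1 else 0) = pderiv R k (a i) := by
          by_cases hi : i ∈ s
          · simp [hi]
          · simp [hi, hs i hi]
        simp only [h1, mul_add, Finset.sum_add_distrib]
        rw [map_mul, MvPolynomial.aeval_X, Derivation.leibniz, hp, ← h2]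
        simp only [smul_eq_mul, Finset.mul_sum]
        congr 1 <;> exact Finset.sum_congr rfl fun j _ => by ring
  exact congrFun key F

theorem constantCoeff_subst_of_constantCoeff_eq_zero {a : σ → MvPowerSeries τ R}
    (ha : HasSubst a) (h0 : ∀ i, constantCoeff (a i) = 0) (F : MvPowerSeries σ R) :
    constantCoeff (subst a F) = constantCoeff F := by
  have h := constantCoeff_subst_eq_zero ha h0 (f := F - C (constantCoeff F)) (by simp)
  rw [subst_sub ha, subst_C, map_sub, constantCoeff_C, sub_eq_zero] at h
  exact h

theorem pderiv_comm (i j : σ) (F : MvPowerSeries σ R) :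
    pderiv R i (pderiv R j F) = pderiv R j (pderiv R i F) := by
  classical
  ext m
  simp only [coeff_pderiv]
  rcases eq_or_ne i j with rfl | h
  · rfl
  · rw [add_right_comm]
    simp [h, h.symm]
    ring

end MvPowerSeries

/-! ### Formal points with finitely many coordinates, and the infinite sums `∑ q_{i+j} Gᵢ` -/

namespace GenusZero

noncomputable section

open MvPowerSeries

/-- A formal point of the small space spanned by the first `N` coordinates. -/
structure IsPoint (N : ℕ) (t : ℕ → PointRing) : Prop where
  const : ∀ i, constantCoeff (t i) = 0
  vanish : ∀ i, N ≤ i → t i = 0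

theorem IsPoint.hasSubst {N : ℕ} {t : ℕ → PointRing} (h : IsPoint N t) : HasSubst t where
  const_coeff i := by simp [h.const i]
  coeff_zero d := (Finset.range N).finite_toSet.subset fun i hi => by
    by_contra hN
    exact hi (by simp [h.vanish i (by simpa using hN)])

/-- The generic point of the space spanned by the first `N` coordinates. -/
def genericPoint (N : ℕ) : ℕ → PointRing := fun i => if i < N then X i else 0

theorem isPoint_genericPoint (N : ℕ) : IsPoint N (genericPoint N) where
  const i := by unfold genericPoint; split_ifs <;> simp
  vanish i hi := by simp [genericPoint, hi]

open Classical in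
theorem coeff_subst_genericPoint (N : ℕ) (F : Potential) (m : ℕ →₀ ℕ) :
    coeff m (subst (genericPoint N) F) = if ∀ i, N ≤ i → m i = 0 then coeff m F else 0 := by
  have hprod : ∀ d : ℕ →₀ ℕ, (d.prod fun s e => genericPoint N s ^ e) =
      if ∀ i, N ≤ i → d i = 0 then monomial d (1 : ℂ) else 0 := by
    intro d
    split_ifs with h
    · rw [monomial_one_eq]
      refine Finsupp.prod_congr fun i hi => ?_
      have : i < N := by
        by_contra hN
        exact (Finsupp.mem_support_iff.mp hi) (h i (not_lt.mp hN))
      simp [genericPoint, this]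
    · push Not at h
      obtain ⟨i, hi, hd⟩ := h
      refine Finset.prod_eq_zero (Finsupp.mem_support_iff.mpr hd) ?_
      simp [genericPoint, hi, hd]
  rw [coeff_subst (isPoint_genericPoint N).hasSubst, finsum_eq_single _ m]
  · rw [hprod]
    split_ifs <;> simp
  · intro d hd
    rw [hprod]
    split_ifs
    · rw [coeff_monomial_ne hd.symm, smul_zero]
    · simp

theorem exists_forall_le_eq_zero (m : ℕ →₀ ℕ) : ∃ N, 2 ≤ N ∧ ∀ i, N ≤ i → m i = 0 := by
  refine ⟨m.support.sup id + 2, by omega, fun i hi => ?_⟩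
  by_contra h0
  have := Finset.le_sup (f := id) (Finsupp.mem_support_iff.mpr h0)
  simp only [id] at this
  omega

/-- A formal function is determined by its values at the generic points. -/
theorem ext_genericPoint {F G : Potential}
    (h : ∀ N, 2 ≤ N → subst (genericPoint N) F = subst (genericPoint N) G) : F = G := by
  ext m
  obtain ⟨N, hN, hm⟩ := exists_forall_le_eq_zero m
  have := congrArg (coeff m) (h N hN)
  rwa [coeff_subst_genericPoint, coeff_subst_genericPoint, if_pos hm, if_pos hm] at this

/-- Evaluation at a point with `N` coordinates factors through truncation to the first `N`
variables, so series may be truncated before they are evaluated. -/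
theorem IsPoint.subst_eq {N : ℕ} {t : ℕ → PointRing} (h : IsPoint N t) (F : Potential) :
    subst t F = subst t (subst (genericPoint N) F) := by
  rw [subst_comp_subst_apply (isPoint_genericPoint N).hasSubst h.hasSubst]
  congr 1
  funext i
  rw [genericPoint]
  split_ifs with hi
  · rw [subst_X h.hasSubst]
  · rw [h.vanish i (not_lt.mp hi), ← coe_substAlgHom h.hasSubst, map_zero]

/-- The dilaton shifted coordinates of a point. -/
def shift (t : ℕ → PointRing) (i : ℕ) : PointRing := t i - if i = 1 then 1 else 0

theorem IsPoint.shift_eq_zero {N : ℕ} {t : ℕ → PointRing} (h : IsPoint N t) (hN : 2 ≤ N) {i : ℕ}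
    (hi : N ≤ i) : shift t i = 0 := by
  simp [shift, h.vanish i hi, show i ≠ 1 by omega]

theorem constantCoeff_q (i : ℕ) : constantCoeff (q i) = if i = 1 then -1 else 0 := by
  unfold q; split_ifs <;> simp

theorem subst_q {t : ℕ → PointRing} (h : HasSubst t) (i : ℕ) : subst t (q i) = shift t i := by
  rw [q, shift, subst_sub h, subst_X h]
  split_ifs
  · rw [← coe_substAlgHom h, map_one]
  · rw [← coe_substAlgHom h, map_zero]

/-- The series `∑ᵢ q_{i+j} Gᵢ`. -/
def qsum (j : ℕ) (G : ℕ → Potential) : Potential := fun m => ∑ᶠ i, coeff m (q (i + j) * G i)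

theorem coeff_qsum (j : ℕ) (G : ℕ → Potential) (m : ℕ →₀ ℕ) :
    coeff m (qsum j G) = ∑ᶠ i, coeff m (q (i + j) * G i) := rfl

theorem finite_support_qsum (j : ℕ) (G : ℕ → Potential) (m : ℕ →₀ ℕ) :
    (Function.support fun i => coeff m (q (i + j) * G i)).Finite :=
  finite_support_coeff_q_mul (· + j) (add_left_injective j) G m

theorem coeff_q_mul_eq_zero {N i : ℕ} (hN : 2 ≤ N) (hi : N ≤ i) {m : ℕ →₀ ℕ}
    (hm : ∀ i, N ≤ i → m i = 0) (G : Potential) : coeff m (q i * G) = 0 := by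
  classical
  have hle : ¬ (Finsupp.single i 1 ≤ m) := by
    intro hle
    have := hle i
    simp [hm i hi] at this
  simp [q, show i ≠ 1 by omega, MvPowerSeries.X, coeff_monomial_mul, hle]

theorem coeff_qsum_eq_sum {N : ℕ} (hN : 2 ≤ N) {m : ℕ →₀ ℕ} (hm : ∀ i, N ≤ i → m i = 0) (j : ℕ)
    (G : ℕ → Potential) :
    coeff m (qsum j G) = ∑ i ∈ Finset.range N, coeff m (q (i + j) * G i) := by
  refine finsum_eq_sum_of_support_subset _ fun i hi => ?_
  by_contra h
  simp only [Finset.coe_range, Set.mem_Iio, not_lt] at h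
  exact hi (coeff_q_mul_eq_zero hN (by omega) hm _)

/-- No continuity argument is needed: after truncation the infinite sum agrees with its first `N`
terms, because `q_{i+j}` itself is truncated away for `i ≥ N`. -/
theorem subst_qsum {N : ℕ} (hN : 2 ≤ N) {t : ℕ → PointRing} (h : IsPoint N t) (j : ℕ)
    (G : ℕ → Potential) :
    subst t (qsum j G) = ∑ i ∈ Finset.range N, shift t (i + j) * subst t (G i) := by
  have key : subst (genericPoint N) (qsum j G) =
      subst (genericPoint N) (∑ i ∈ Finset.range N, q (i + j) * G i) := by
    ext m
    rw [coeff_subst_genericPoint, coeff_subst_genericPoint]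
    split_ifs with hm
    · rw [coeff_qsum_eq_sum hN hm, map_sum]
    · rfl
  rw [h.subst_eq, key, ← h.subst_eq, ← coe_substAlgHom h.hasSubst, map_sum]
  refine Finset.sum_congr rfl fun i _ => ?_
  rw [map_mul, coe_substAlgHom, subst_q h.hasSubst]

theorem pd_q (k i : ℕ) : pd k (q i) = if i = k then 1 else 0 := by
  unfold pd q
  rw [map_sub, pderiv_X, Pi.single_apply]
  split_ifs <;> simp

theorem pd_mul (k : ℕ) (F G : Potential) : pd k (F * G) = F * pd k G + G * pd k F := by
  simp [pd]

theorem pd_comm (k l : ℕ) (F : Potential) : pd k (pd l F) = pd l (pd k F) := pderiv_comm k l F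

theorem coeff_pd (k : ℕ) (F : Potential) (m : ℕ →₀ ℕ) :
    coeff m (pd k F) = coeff (m + Finsupp.single k 1) F * (m k + 1) := coeff_pderiv F m

theorem constantCoeff_qsum (j : ℕ) (hj : j ≤ 1) (G : ℕ → Potential) :
    constantCoeff (qsum j G) = -constantCoeff (G (1 - j)) := by
  rw [← coeff_zero_eq_constantCoeff_apply, coeff_qsum, finsum_eq_single _ (1 - j)]
  · rw [coeff_zero_eq_constantCoeff_apply, map_mul, constantCoeff_q, if_pos (by omega)]
    ring
  · intro i hi
    rw [coeff_zero_eq_constantCoeff_apply, map_mul, constantCoeff_q, if_neg (by omega), zero_mul]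

/-- Leibniz rule; the extra term comes from the single index with `q_{i+j} = q_k`, which exists only
for `j ≤ k`. -/
theorem pd_qsum (k j : ℕ) (G : ℕ → Potential) :
    pd k (qsum j G) = qsum j (fun i => pd k (G i)) + if j ≤ k then G (k - j) else 0 := by
  ext m
  have hsplit : ∀ i, coeff (m + Finsupp.single k 1) (q (i + j) * G i) * ((m k : ℂ) + 1) =
      coeff m (q (i + j) * pd k (G i)) + coeff m (if i + j = k then G i else 0) := by
    intro i
    rw [← coeff_pd, pd_mul, pd_q, map_add]
    split_ifs <;> simp
  have hfin : (Function.support fun i => coeff m (if i + j = k then G i else 0)).Finite := by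
    refine (Set.finite_singleton (k - j)).subset fun i hi => ?_
    by_contra h
    have : i + j ≠ k := fun h' => h (by simp; omega)
    exact hi (by simp [this])
  rw [coeff_pd, coeff_qsum, finsum_mul _ _, map_add, coeff_qsum]
  simp only [hsplit]
  rw [finsum_add_distrib (finite_support_qsum j _ m) hfin]
  congr 1
  split_ifs with hjk
  · rw [finsum_eq_single _ (k - j)]
    · rw [if_pos (by omega)]
    · intro i hi
      rw [if_neg (by omega), map_zero]
  · rw [finsum_eq_zero_of_forall_eq_zero]
    · simp
    · intro i
      rw [if_neg (by omega), map_zero]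

theorem qsum_congr_subst {j : ℕ} {G : ℕ → Potential} {F : Potential}
    (h : ∀ N, 2 ≤ N → ∑ i ∈ Finset.range N,
      shift (genericPoint N) (i + j) * subst (genericPoint N) (G i) = subst (genericPoint N) F) :
    qsum j G = F :=
  ext_genericPoint fun N hN => by rw [subst_qsum hN (isPoint_genericPoint N), h N hN]

theorem qsum_add (j : ℕ) (G H : ℕ → Potential) :
    qsum j (fun i => G i + H i) = qsum j G + qsum j H := by
  refine qsum_congr_subst fun N hN => ?_
  have hp := isPoint_genericPoint N
  rw [subst_add hp.hasSubst, subst_qsum hN hp, subst_qsum hN hp, ← Finset.sum_add_distrib]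
  exact Finset.sum_congr rfl fun i _ => by rw [subst_add hp.hasSubst, mul_add]

theorem qsum_mul (j : ℕ) (F : Potential) (G : ℕ → Potential) :
    qsum j (fun i => F * G i) = F * qsum j G := by
  refine qsum_congr_subst fun N hN => ?_
  have hp := isPoint_genericPoint N
  rw [subst_mul hp.hasSubst, subst_qsum hN hp, Finset.mul_sum]
  exact Finset.sum_congr rfl fun i _ => by rw [subst_mul hp.hasSubst]; ring

theorem dilatonEq_iff (F : Potential) : DilatonEq F ↔ qsum 0 (fun i => pd i F) = 2 * F := by
  rw [MvPowerSeries.ext_iff]; rfl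

theorem stringEq_iff (F : Potential) :
    StringEq F ↔ qsum 1 (fun i => pd i F) = C (-(1 / 2 : ℂ)) * q 0 ^ 2 := by
  rw [MvPowerSeries.ext_iff]
  simp only [coeff_C_mul]
  rfl

end

end GenusZero

/-! ### The quadratic form `W`, the transformed potential, and invariance of the three equations -/

namespace GenusZero

noncomputable section

open MvPowerSeries

/-- The series `T_{k+1} - T_{k+2} X + T_{k+3} X² - ⋯`. -/
def alternatingTail (T : ℂ⟦X⟧) (k : ℕ) : ℂ⟦X⟧ :=
  PowerSeries.mk fun j => (-1) ^ j * PowerSeries.coeff (k + 1 + j) T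

theorem alternatingTail_eq (T : ℂ⟦X⟧) (k : ℕ) :
    alternatingTail T k =
      PowerSeries.C (PowerSeries.coeff (k + 1) T) - PowerSeries.X * alternatingTail T (k + 1) := by
  ext n
  cases n with
  | zero => simp [alternatingTail]
  | succ n =>
    rw [map_sub, PowerSeries.coeff_succ_X_mul, alternatingTail, alternatingTail,
      PowerSeries.coeff_mk, PowerSeries.coeff_mk, PowerSeries.coeff_C, if_neg (by omega),
      show k + 1 + (n + 1) = k + 1 + 1 + n by ring]
    ring

theorem coeff_evalNegHom (T : ℂ⟦X⟧) (n : ℕ) :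
    PowerSeries.coeff n (PowerSeries.evalNegHom T) = (-1) ^ n * PowerSeries.coeff n T := by
  simp [PowerSeries.evalNegHom, PowerSeries.coeff_rescale]

theorem evalNegHom_evalNegHom (T : ℂ⟦X⟧) :
    PowerSeries.evalNegHom (PowerSeries.evalNegHom T) = T := by
  ext n
  rw [coeff_evalNegHom, coeff_evalNegHom, ← mul_assoc, ← mul_pow]
  simp

theorem evalNegHom_eq {T : ℂ⟦X⟧} (h0 : PowerSeries.coeff 0 T = 1) :
    PowerSeries.evalNegHom T = 1 - PowerSeries.X * alternatingTail T 0 := by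
  ext n
  rw [coeff_evalNegHom]
  cases n with
  | zero => simpa using h0
  | succ n =>
    rw [map_sub, PowerSeries.coeff_succ_X_mul, alternatingTail, PowerSeries.coeff_mk,
      PowerSeries.coeff_one, if_neg (by omega), show 0 + 1 + n = n + 1 by ring]
    ring

/-- The coefficients `W_{kl}` of the quadratic form
`∑ W_{kl} w^k z^l = (T(w) T(z) - 1) / (w + z)` when `T(-z) T(z) = 1`. -/
def pairing (T : ℂ⟦X⟧) (k l : ℕ) : ℂ := PowerSeries.coeff l (alternatingTail T k * T)

theorem pairing_zero_right (T : ℂ⟦X⟧) (k : ℕ) :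
    pairing T k 0 = PowerSeries.coeff (k + 1) T * PowerSeries.coeff 0 T := by
  simp [pairing, alternatingTail]

theorem pairing_succ_right (T : ℂ⟦X⟧) (k l : ℕ) :
    pairing T k (l + 1) =
      PowerSeries.coeff (k + 1) T * PowerSeries.coeff (l + 1) T - pairing T (k + 1) l := by
  rw [pairing, alternatingTail_eq, sub_mul, map_sub, PowerSeries.coeff_C_mul, mul_assoc,
    PowerSeries.coeff_succ_X_mul, pairing]

/-- The conditions on `T(z) = S(-z)` for an element `S` of `G₋` with `S₁ = 0`. -/
structure IsCalibration (T : ℂ⟦X⟧) : Prop where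
  coeff_zero : PowerSeries.coeff 0 T = 1
  coeff_one : PowerSeries.coeff 1 T = 0
  symplectic : PowerSeries.evalNegHom T * T = 1

namespace IsCalibration

variable {T : ℂ⟦X⟧}

/-- This is the coefficient of `X^{l+1}` in `T(-X) T(X) = 1`, with `T(-X) = 1 - X * alternatingTail
T 0`. -/
theorem pairing_zero_left (h : IsCalibration T) (l : ℕ) :
    pairing T 0 l = PowerSeries.coeff (l + 1) T := by
  have := congrArg (PowerSeries.coeff (l + 1)) h.symplectic
  rw [evalNegHom_eq h.coeff_zero, sub_mul, one_mul, map_sub, mul_assoc,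
    PowerSeries.coeff_succ_X_mul, PowerSeries.coeff_one, if_neg (by omega), sub_eq_zero] at this
  exact this.symm

/-- The recursion `W_{k,l+1} + W_{k+1,l} = T_{k+1} T_{l+1}` is symmetric in `k` and `l`; the
symplectic condition supplies the matching boundary values. -/
theorem pairing_comm (h : IsCalibration T) (k l : ℕ) : pairing T k l = pairing T l k := by
  induction k generalizing l with
  | zero => rw [h.pairing_zero_left, pairing_zero_right, h.coeff_zero, mul_one]
  | succ k ih =>
    have h1 := pairing_succ_right T k l
    have h2 := pairing_succ_right T l k
    rw [ih] at h1
    linear_combination h1 - h2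

end IsCalibration

theorem constantCoeff_qsum_of_two_le {j : ℕ} (hj : 2 ≤ j) (G : ℕ → Potential) :
    constantCoeff (qsum j G) = 0 := by
  rw [← coeff_zero_eq_constantCoeff_apply, coeff_qsum, finsum_eq_zero_of_forall_eq_zero]
  intro i
  rw [coeff_zero_eq_constantCoeff_apply, map_mul, constantCoeff_q, if_neg (by omega), zero_mul]

theorem pd_C (k : ℕ) (c : ℂ) : pd k (C c) = 0 := pderiv_C

theorem pd_add (k : ℕ) (F G : Potential) : pd k (F + G) = pd k F + pd k G := map_add _ F G

theorem pd_sub (k : ℕ) (F G : Potential) : pd k (F - G) = pd k F - pd k G := map_sub _ F G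

theorem pd_sum {ι : Type*} (k : ℕ) (s : Finset ι) (F : ι → Potential) :
    pd k (∑ i ∈ s, F i) = ∑ i ∈ s, pd k (F i) := map_sum (pderiv ℂ k) F s

theorem pd_C_mul (k : ℕ) (c : ℂ) (F : Potential) : pd k (C c * F) = C c * pd k F := by
  rw [pd_mul, pd_C, mul_zero, add_zero]

theorem pd_one (k : ℕ) : pd k 1 = 0 := pderiv_one

theorem pd_zero (k : ℕ) : pd k 0 = 0 := map_zero (pderiv ℂ k)

theorem qsum_zero (j : ℕ) : qsum j (fun _ => 0) = 0 := by
  simpa using qsum_mul j 0 (fun _ => 0)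

/-- The linear change of variables `q(z) ↦ [T(z⁻¹) q(z)]₊`, in the variables `t`. -/
def linearPart (T : ℂ⟦X⟧) (j : ℕ) : Potential :=
  qsum j (fun k => C (PowerSeries.coeff k T)) + if j = 1 then 1 else 0

/-- The linear form `∑ W_{kl} q_l`. -/
def gradPart (T : ℂ⟦X⟧) (k : ℕ) : Potential := qsum 0 (fun l => C (pairing T k l))

/-- The quadratic form `(1/2) ∑ W_{kl} q_k q_l`. -/
def quadPart (T : ℂ⟦X⟧) : Potential := C (1 / 2) * qsum 0 (gradPart T)

/-- The potential whose cone is `T(-z) 𝓛_F`. -/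
def transform (T : ℂ⟦X⟧) (F : Potential) : Potential := subst (linearPart T) F + quadPart T

/-- The pullback of the coordinate vector field `∂_k` under the linear change of variables. -/
def pullbackPd (T : ℂ⟦X⟧) (k : ℕ) (F : Potential) : Potential :=
  ∑ j ∈ Finset.range (k + 1), C (PowerSeries.coeff (k - j) T) * pd j F

theorem pd_linearPart (T : ℂ⟦X⟧) (k j : ℕ) :
    pd k (linearPart T j) = if j ≤ k then C (PowerSeries.coeff (k - j) T) else 0 := by
  have : pd k (if j = 1 then (1 : Potential) else 0) = 0 := by
    split_ifs
    · exact pd_one k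
    · exact pd_zero k
  rw [linearPart, pd_add, this, pd_qsum]
  simp [pd_C, qsum_zero]

theorem pd_gradPart (T : ℂ⟦X⟧) (k l : ℕ) : pd k (gradPart T l) = C (pairing T l k) := by
  rw [gradPart, pd_qsum]
  simp [pd_C, qsum_zero]

theorem pullbackPd_zero {T : ℂ⟦X⟧} (h0 : PowerSeries.coeff 0 T = 1) (F : Potential) :
    pullbackPd T 0 F = pd 0 F := by
  rw [pullbackPd, zero_add, Finset.sum_range_one, Nat.sub_zero, h0, map_one, one_mul]

theorem shift_subst_linearPart (T : ℂ⟦X⟧) {N : ℕ} (hN : 2 ≤ N) {t : ℕ → PointRing}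
    (ht : IsPoint N t) (j : ℕ) : shift (fun j => subst t (linearPart T j)) j =
      ∑ i ∈ Finset.range N, C (PowerSeries.coeff i T) * shift t (i + j) := by
  have h1 : subst t (if j = 1 then (1 : Potential) else 0) = if j = 1 then 1 else 0 := by
    rw [← coe_substAlgHom ht.hasSubst]
    split_ifs
    · exact map_one _
    · exact map_zero _
  rw [shift, linearPart, subst_add ht.hasSubst, h1, add_sub_cancel_right, subst_qsum hN ht]
  exact Finset.sum_congr rfl fun i _ => by rw [subst_C, mul_comm]

namespace IsCalibration

variable {T : ℂ⟦X⟧}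

/-- At `q = -z` the new `t₀` equals `-T₁`, so `T₁ = 0` is what makes the substitution legitimate.
For `t₁` the dilaton shift cancels `-T₀ = -1`. -/
theorem constantCoeff_linearPart (h : IsCalibration T) (j : ℕ) :
    constantCoeff (linearPart T j) = 0 := by
  rw [linearPart, map_add]
  match j with
  | 0 => rw [constantCoeff_qsum 0 (by omega)]; simp [h.coeff_one]
  | 1 => rw [constantCoeff_qsum 1 le_rfl, Nat.sub_self, h.coeff_zero]; simp
  | j + 2 => rw [constantCoeff_qsum_of_two_le (by omega)]; simp

theorem hasSubst (h : IsCalibration T) : HasSubst (linearPart T) where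
  const_coeff j := by simp [h.constantCoeff_linearPart j]
  coeff_zero d := by
    obtain ⟨N, hN2, hd⟩ := exists_forall_le_eq_zero d
    refine (Finset.range N).finite_toSet.subset fun j hj => ?_
    by_contra hN
    simp only [Finset.coe_range, Set.mem_Iio, not_lt] at hN
    refine hj ?_
    rw [linearPart, if_neg (by omega), add_zero, coeff_qsum_eq_sum (by omega) hd]
    exact Finset.sum_eq_zero fun i _ => coeff_q_mul_eq_zero (by omega) (by omega) hd _

theorem isPoint_subst (h : IsCalibration T) {N : ℕ} (hN : 2 ≤ N) {t : ℕ → PointRing}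
    (ht : IsPoint N t) : IsPoint N (fun j => subst t (linearPart T j)) where
  const j := by
    rw [constantCoeff_subst_of_constantCoeff_eq_zero ht.hasSubst ht.const,
      h.constantCoeff_linearPart]
  vanish j hj := by
    rw [linearPart, if_neg (by omega), add_zero, subst_qsum hN ht]
    refine Finset.sum_eq_zero fun i _ => ?_
    rw [ht.shift_eq_zero hN (by omega), zero_mul]

/-- The chain rule has finitely many terms because `t_k` occurs in the `j`-th new coordinate only
for `j ≤ k`. -/
theorem pd_subst (h : IsCalibration T) (k : ℕ) (F : Potential) :
    pd k (subst (linearPart T) F) = subst (linearPart T) (pullbackPd T k F) := by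
  have := pderiv_subst h.hasSubst k (Finset.range (k + 1)) (fun j hj => by
    have := pd_linearPart T k j
    rw [if_neg (by simpa using hj)] at this
    exact this) F
  rw [pullbackPd, ← coe_substAlgHom h.hasSubst, map_sum]
  simp only [map_mul, coe_substAlgHom, subst_C]
  refine this.trans (Finset.sum_congr rfl fun j hj => ?_)
  have h2 := pd_linearPart T k j
  rw [if_pos (by simpa [Nat.lt_succ_iff] using hj)] at h2
  exact congrArg (· * _) h2

theorem pd_quadPart (h : IsCalibration T) (k : ℕ) : pd k (quadPart T) = gradPart T k := by
  rw [quadPart, pd_C_mul, pd_qsum]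
  simp only [pd_gradPart, Nat.zero_le, if_true, Nat.sub_zero]
  simp only [h.pairing_comm _ k]
  change C (1 / 2) * (gradPart T k + gradPart T k) = _
  rw [← two_mul, ← mul_assoc, show (2 : Potential) = C 2 from (map_ofNat C 2).symm, ← map_mul]
  norm_num

theorem pd_transform (h : IsCalibration T) (k : ℕ) (F : Potential) :
    pd k (transform T F) = subst (linearPart T) (pullbackPd T k F) + gradPart T k := by
  rw [transform, pd_add, h.pd_subst, h.pd_quadPart]

theorem pd_pd_transform (h : IsCalibration T) (k l : ℕ) (F : Potential) :
    pd k (pd l (transform T F)) =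
      subst (linearPart T) (pullbackPd T k (pullbackPd T l F)) + C (pairing T l k) := by
  rw [h.pd_transform, pd_add, h.pd_subst, pd_gradPart]

theorem pd_pd_pd_transform (h : IsCalibration T) (k l m : ℕ) (F : Potential) :
    pd k (pd l (pd m (transform T F))) =
      subst (linearPart T) (pullbackPd T k (pullbackPd T l (pullbackPd T m F))) := by
  rw [h.pd_pd_transform, pd_add, h.pd_subst, pd_C, add_zero]

end IsCalibration

theorem TRR.pullback {F : Potential} (hF : TRR F) (T : ℂ⟦X⟧) (k l m : ℕ) :
    pd (k + 1) (pullbackPd T l (pullbackPd T m F)) =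
      pd k (pd 0 F) * pd 0 (pullbackPd T l (pullbackPd T m F)) := by
  simp only [pullbackPd, pd_sum, pd_C_mul, Finset.mul_sum]
  refine Finset.sum_congr rfl fun i _ => Finset.sum_congr rfl fun j _ => ?_
  rw [hF]
  ring

/-- In the pullback of `∂_{k+1}` the terms with `j ≥ 1` obey the recursion for `F`. The leftover
term `T_{k+1} ∂₀` is accounted for by the constant `W_{0k} = T_{k+1}` in the second derivative of
the quadratic part. -/
theorem TRR.transform {F : Potential} (hF : TRR F) {T : ℂ⟦X⟧} (h : IsCalibration T) :
    TRR (transform T F) := by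
  intro k l m
  rw [h.pd_pd_pd_transform, h.pd_pd_pd_transform, h.pd_pd_transform, pullbackPd_zero h.coeff_zero,
    pullbackPd_zero h.coeff_zero, h.pairing_zero_left]
  set H := pullbackPd T l (pullbackPd T m F) with hH
  have h1 : pullbackPd T (k + 1) H =
      (pullbackPd T k (pd 0 F) + C (PowerSeries.coeff (k + 1) T)) * pd 0 H := by
    rw [pullbackPd, Finset.sum_range_succ', pullbackPd, add_mul, Finset.sum_mul, Nat.sub_zero]
    congr 1
    refine Finset.sum_congr rfl fun j _ => ?_
    rw [hH, hF.pullback T, Nat.add_sub_add_right, mul_assoc]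
  rw [h1, subst_mul h.hasSubst, subst_add h.hasSubst, subst_C]

/-- Rearranging a sum over a square, all of whose terms beyond the diagonal vanish. -/
theorem sum_range_sum_range_eq_sum_antidiagonal {M : Type*} [AddCommMonoid M] {N : ℕ}
    (f : ℕ → ℕ → M) (hf : ∀ i j, N ≤ i + j → f i j = 0) :
    ∑ i ∈ Finset.range N, ∑ j ∈ Finset.range N, f i j =
      ∑ n ∈ Finset.range N, ∑ ij ∈ Finset.HasAntidiagonal.antidiagonal n, f ij.1 ij.2 := by
  rw [← Finset.sum_product', Finset.sum_sigma']
  symm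
  refine Finset.sum_of_injOn (fun x => x.2) ?_ ?_ ?_ ?_
  · rintro ⟨n, i, j⟩ h1 ⟨n', i', j'⟩ h2 h3
    simp only [Finset.coe_sigma, Set.mem_sigma_iff, Finset.mem_coe, Finset.HasAntidiagonal.mem_antidiagonal,
      Prod.mk.injEq] at h1 h2 h3
    obtain ⟨rfl, rfl⟩ := h3
    obtain rfl : n = n' := h1.2.symm.trans h2.2
    rfl
  · rintro ⟨n, i, j⟩ h1
    simp only [Finset.coe_sigma, Set.mem_sigma_iff, Finset.mem_coe, Finset.HasAntidiagonal.mem_antidiagonal,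
      Finset.mem_range] at h1
    simp only [Finset.coe_product, Set.mem_prod, Finset.mem_coe, Finset.mem_range]
    omega
  · rintro ⟨i, j⟩ _ h2
    refine hf i j ?_
    by_contra hlt
    exact h2 ⟨⟨i + j, i, j⟩, by simp; omega, rfl⟩
  · intro x _
    rfl

/-- Applying two power series in the shift operator one after the other. -/
theorem sum_coeff_mul_sum_coeff_mul {N : ℕ} (T U : ℂ⟦X⟧) (x : ℕ → PointRing) (j : ℕ)
    (hx : ∀ i, N ≤ i → x i = 0) :
    ∑ i ∈ Finset.range N, C (PowerSeries.coeff i T) *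
        ∑ k ∈ Finset.range N, C (PowerSeries.coeff k U) * x (k + (i + j)) =
      ∑ n ∈ Finset.range N, C (PowerSeries.coeff n (T * U)) * x (n + j) := by
  simp only [Finset.mul_sum]
  rw [sum_range_sum_range_eq_sum_antidiagonal]
  · refine Finset.sum_congr rfl fun n _ => ?_
    rw [PowerSeries.coeff_mul, map_sum, Finset.sum_mul]
    refine Finset.sum_congr rfl fun ik hik => ?_
    rw [← Finset.HasAntidiagonal.mem_antidiagonal.mp hik, map_mul, mul_assoc,
      show ik.2 + (ik.1 + j) = ik.1 + ik.2 + j by ring]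
  · intro i k hik
    rw [hx _ (by omega), mul_zero, mul_zero]

/-- Multiplication by `T(z⁻¹)` commutes with shifting the powers of `z`, so the vector fields `∑
q_{k+s} ∂_k` correspond under the change of variables. On finite sums this is a reindexing along
antidiagonals. -/
theorem IsCalibration.qsum_pullback {T : ℂ⟦X⟧} (h : IsCalibration T) (s : ℕ)
    (G : ℕ → Potential) :
    qsum s (fun k => subst (linearPart T)
      (∑ j ∈ Finset.range (k + 1), C (PowerSeries.coeff (k - j) T) * G j)) =
      subst (linearPart T) (qsum s G) := by
  refine qsum_congr_subst fun N hN => ?_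
  have ht := isPoint_genericPoint N
  set t := genericPoint N
  have hAt := h.isPoint_subst hN ht
  set t' := fun j => subst t (linearPart T j) with ht'
  have hc : ∀ H : Potential, subst t (subst (linearPart T) H) = subst t' H := fun H =>
    subst_comp_subst_apply h.hasSubst ht.hasSubst H
  rw [hc, subst_qsum hN hAt]
  simp only [hc, ht', shift_subst_linearPart T hN ht]
  simp only [← ht', Finset.sum_mul]
  rw [sum_range_sum_range_eq_sum_antidiagonal]
  · refine Finset.sum_congr rfl fun n _ => ?_
    rw [← coe_substAlgHom hAt.hasSubst, map_sum, Finset.mul_sum,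
      Finset.Nat.sum_antidiagonal_eq_sum_range_succ_mk]
    refine Finset.sum_congr rfl fun j hj => ?_
    have : n - j + (j + s) = n + s := by
      have := Finset.mem_range.mp hj
      omega
    simp only [map_mul, coe_substAlgHom, subst_C, this]
    ring
  · intro i j hij
    rw [ht.shift_eq_zero hN (by omega), mul_zero, zero_mul]

theorem DilatonEq.transform {F : Potential} (hF : DilatonEq F) {T : ℂ⟦X⟧} (h : IsCalibration T) :
    DilatonEq (transform T F) := by
  rw [dilatonEq_iff] at hF ⊢
  have h2 : (2 : Potential) = C 2 := (map_ofNat C 2).symm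
  have h1 := h.qsum_pullback 0 (fun i => pd i F)
  simp only [h.pd_transform, qsum_add]
  simp only [pullbackPd]
  rw [h1, hF, GenusZero.transform, mul_add, quadPart, ← mul_assoc, h2, ← map_mul,
    subst_mul h.hasSubst, subst_C]
  norm_num

/-- This is `(w + z) W(w, z) = T(w) T(z) - 1` read as an identity of quadratic forms: `T(w) T(z)`
gives the square of the new `q₀`, and `-1` gives `-q₀²`. -/
theorem IsCalibration.qsum_gradPart {T : ℂ⟦X⟧} (h : IsCalibration T) :
    qsum 1 (gradPart T) = C (1 / 2) * (linearPart T 0 ^ 2 - q 0 ^ 2) := by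
  refine qsum_congr_subst fun N hN => ?_
  have ht := isPoint_genericPoint N
  set t := genericPoint N
  have hz : ∀ i, N ≤ i → shift t i = 0 := fun i => ht.shift_eq_zero hN
  have hs : subst t (C (1 / 2) * (linearPart T 0 ^ 2 - q 0 ^ 2)) =
      C (1 / 2) * (subst t (linearPart T 0) ^ 2 - shift t 0 ^ 2) := by
    rw [subst_mul ht.hasSubst, subst_C, subst_sub ht.hasSubst, subst_pow ht.hasSubst,
      subst_pow ht.hasSubst, subst_q ht.hasSubst]
  have hdrop : ∀ f : ℕ → PointRing, ∑ i ∈ Finset.range N, f i * shift t i =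
      f 0 * shift t 0 + ∑ i ∈ Finset.range N, f (i + 1) * shift t (i + 1) := by
    intro f
    rw [add_comm, ← Finset.sum_range_succ' (fun i => f i * shift t i), Finset.sum_range_succ,
      hz N le_rfl, mul_zero, add_zero]
  rw [hs, linearPart, if_neg (by omega), add_zero, subst_qsum hN ht]
  simp only [gradPart, subst_qsum hN ht, subst_C, add_zero]
  have e1 : ∑ i ∈ Finset.range N, shift t i * C (PowerSeries.coeff i T) = shift t 0 +
      ∑ i ∈ Finset.range N, C (PowerSeries.coeff (i + 1) T) * shift t (i + 1) := by
    have := hdrop fun i => C (PowerSeries.coeff i T)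
    rw [h.coeff_zero, map_one, one_mul] at this
    rw [← this]
    exact Finset.sum_congr rfl fun i _ => mul_comm _ _
  set A := ∑ i ∈ Finset.range N, C (PowerSeries.coeff (i + 1) T) * shift t (i + 1) with hA
  set B : PointRing := ∑ k ∈ Finset.range N, ∑ l ∈ Finset.range N,
    C (pairing T k (l + 1)) * shift t (k + 1) * shift t (l + 1) with hB
  have e2 : ∑ k ∈ Finset.range N, shift t (k + 1) *
      ∑ l ∈ Finset.range N, shift t l * C (pairing T k l) = A * shift t 0 + B := by
    rw [hA, hB, Finset.sum_mul, ← Finset.sum_add_distrib]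
    refine Finset.sum_congr rfl fun k _ => ?_
    have := hdrop fun l => C (pairing T k l)
    simp only [pairing_zero_right, h.coeff_zero, mul_one] at this
    simp only [mul_comm (shift t _) (C (pairing T k _))]
    rw [this, mul_add, Finset.mul_sum]
    congr 1
    · ring
    · exact Finset.sum_congr rfl fun l _ => by ring
  -- Summing `T_{k+1} T_{l+1} = W_{k,l+1} + W_{k+1,l}` against `q_{k+1} q_{l+1}` gives two sums,
  -- equal by the symmetry of `W`.
  have e3 : A * A = B + B := by
    have hB' : B = ∑ k ∈ Finset.range N, ∑ l ∈ Finset.range N,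
        C (pairing T (k + 1) l) * shift t (k + 1) * shift t (l + 1) := by
      rw [hB, Finset.sum_comm]
      refine Finset.sum_congr rfl fun k _ => Finset.sum_congr rfl fun l _ => ?_
      rw [h.pairing_comm]
      ring
    nth_rewrite 2 [hB']
    rw [hA, hB, Finset.sum_mul_sum, ← Finset.sum_add_distrib]
    refine Finset.sum_congr rfl fun k _ => ?_
    rw [← Finset.sum_add_distrib]
    refine Finset.sum_congr rfl fun l _ => ?_
    rw [pairing_succ_right, map_sub, map_mul]
    ring
  rw [e1, e2]
  have h2 : (C (1 / 2) : PointRing) * 2 = 1 := by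
    rw [show (2 : PointRing) = C 2 from (map_ofNat C 2).symm, ← map_mul]
    norm_num
  linear_combination (-(A * shift t 0) - B) * h2 - C (1 / 2) * e3

theorem StringEq.transform {F : Potential} (hF : StringEq F) {T : ℂ⟦X⟧} (h : IsCalibration T) :
    StringEq (transform T F) := by
  rw [stringEq_iff] at hF ⊢
  have h1 := h.qsum_pullback 1 (fun i => pd i F)
  have h0 : subst (linearPart T) (q 0) = linearPart T 0 := by
    rw [subst_q h.hasSubst, shift, if_neg (by omega), sub_zero]
  simp only [h.pd_transform, qsum_add]
  simp only [pullbackPd]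
  rw [h1, hF, subst_mul h.hasSubst, subst_pow h.hasSubst, subst_C, h0]
  change _ + qsum 1 (gradPart T) = _
  rw [h.qsum_gradPart, map_neg]
  ring

theorem IsCalibration.transform_mem {T : ℂ⟦X⟧} (h : IsCalibration T) {F : Potential}
    (hF : F ∈ GW₀) : transform T F ∈ GW₀ :=
  ⟨hF.1.transform h, hF.2.1.transform h, hF.2.2.transform h⟩

end

end GenusZero

/-! ### The action on cones -/

namespace GenusZero

noncomputable section

open MvPowerSeries

/-- The coefficients of a product with a power series in `z⁻¹`. -/
theorem coeff_ofPowerSeries_mul {R : Type*} [CommRing R] (S : R⟦X⟧) (f : LaurentSeries R) (n : ℤ)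
    (M : ℕ) (hf : ∀ i : ℕ, M ≤ i → f.coeff (n - i) = 0) :
    (HahnSeries.ofPowerSeries ℤ R S * f).coeff n =
      ∑ i ∈ Finset.range M, PowerSeries.coeff i S * f.coeff (n - i) := by
  classical
  have hS : ∀ i : ℕ, (HahnSeries.ofPowerSeries ℤ R S).coeff (i : ℤ) = PowerSeries.coeff i S :=
    HahnSeries.ofPowerSeries_apply_coeff S
  rw [HahnSeries.coeff_mul]
  symm
  rw [← Finset.sum_filter_ne_zero (s := Finset.range M)]
  refine Finset.sum_of_injOn (fun i : ℕ => ((i : ℤ), n - i)) ?_ ?_ ?_ ?_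
  · intro i _ j _ hij
    simpa using hij
  · intro i hi
    simp only [Finset.coe_filter, Set.mem_ofPred_eq] at hi
    simp only [Finset.mem_coe, Finset.mem_antidiagonal, HahnSeries.mem_support, hS]
    exact ⟨left_ne_zero_of_mul hi.2, right_ne_zero_of_mul hi.2, by ring⟩
  · rintro ⟨a, b⟩ hab hne
    simp only [Finset.mem_antidiagonal, HahnSeries.mem_support] at hab
    obtain ⟨ha, hb, hn⟩ := hab
    rcases lt_or_ge a 0 with h | h
    · refine absurd (PowerSeries.coeff_coe S a) ?_
      rw [if_pos h]
      exact ha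
    · lift a to ℕ using h
      obtain rfl : b = n - a := by omega
      by_contra h0
      refine hne ⟨a, ?_, rfl⟩
      simp only [Finset.coe_filter, Set.mem_ofPred_eq, Finset.mem_range]
      refine ⟨?_, by rwa [hS] at h0⟩
      by_contra hM
      exact hb (hf a (not_lt.mp hM))
  · intro i _
    simp [hS]

theorem IsCalibration.evalNegHom {T : ℂ⟦X⟧} (h : IsCalibration T) :
    IsCalibration (PowerSeries.evalNegHom T) where
  coeff_zero := by rw [coeff_evalNegHom, h.coeff_zero, pow_zero, one_mul]
  coeff_one := by rw [coeff_evalNegHom, h.coeff_one, mul_zero]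
  symplectic := by rw [evalNegHom_evalNegHom, mul_comm, h.symplectic]

/-- The multiplication by `S(z)` in the loop space. -/
def loopMul (S : ℂ⟦X⟧) (f : LoopSpace) : LoopSpace :=
  HahnSeries.ofPowerSeries ℤ PointRing (PowerSeries.map (algebraMap ℂ PointRing) S) * f

theorem translate_eq (S : ℂ⟦X⟧) (L : Set LoopSpace) : translate S L = loopMul S '' L := rfl

theorem loopMul_loopMul (S T : ℂ⟦X⟧) (f : LoopSpace) :
    loopMul S (loopMul T f) = loopMul (S * T) f := by
  simp only [loopMul, map_mul, mul_assoc]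

theorem loopMul_one (f : LoopSpace) : loopMul 1 f = f := by simp [loopMul]

theorem translate_translate (S T : ℂ⟦X⟧) (L : Set LoopSpace) :
    translate S (translate T L) = translate (S * T) L := by
  simp only [translate_eq, Set.image_image, loopMul_loopMul]

theorem coeff_loopMul (S : ℂ⟦X⟧) (f : LoopSpace) (n : ℤ) (M : ℕ)
    (hf : ∀ i : ℕ, M ≤ i → f.coeff (n - i) = 0) :
    (loopMul S f).coeff n =
      ∑ i ∈ Finset.range M, C (PowerSeries.coeff i S) * f.coeff (n - i) := by
  rw [loopMul, coeff_ofPowerSeries_mul _ _ _ M hf]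
  rfl

/-- A Laurent series in `z⁻¹` has finitely many positive powers of `z`, so its order bounds the
number of nonzero coordinates. -/
theorem mem_cone_iff {F : Potential} {f : LoopSpace} :
    f ∈ cone F ↔ ∃ N t, 2 ≤ N ∧ IsPoint N t ∧ (∀ i : ℕ, f.coeff (-(i : ℤ)) = shift t i) ∧
      ∀ i : ℕ, f.coeff ((i : ℤ) + 1) = (-1) ^ (i + 1) * subst t (pd i F) := by
  constructor
  · rintro ⟨t, h0, hq, hp⟩
    refine ⟨(-f.order).toNat + 2, t, by omega, ⟨h0, fun i hi => ?_⟩, hq, hp⟩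
    have h1 := hq i
    rwa [if_neg (by omega), sub_zero, HahnSeries.coeff_eq_zero_of_lt_order (by omega),
      eq_comm] at h1
  · rintro ⟨N, t, _, h, hq, hp⟩
    exact ⟨t, h.const, hq, hp⟩

theorem shift_injective : Function.Injective shift := by
  intro t u h
  funext i
  have := congrFun h i
  rwa [shift, shift, sub_left_inj] at this

theorem sum_C_coeff_one_mul {N : ℕ} (x : ℕ → PointRing) (j : ℕ)
    (hx : ∀ i, N ≤ i → x i = 0) :
    ∑ n ∈ Finset.range N, C (PowerSeries.coeff n (1 : ℂ⟦X⟧)) * x (n + j) = x j := by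
  rcases Nat.eq_zero_or_pos N with rfl | hN
  · simp [hx j (Nat.zero_le j)]
  · rw [Finset.sum_eq_single_of_mem 0 (Finset.mem_range.mpr hN)]
    · simp
    · intro n _ hn
      simp [PowerSeries.coeff_one, hn]

/-- The point over `t` moves to the point over `t' = [S q]₊`. As `T S = 1`, the change of variables
takes `t'` back to `t`, so `dF` is still evaluated at `t`; the powers of `z` pushed to the negative
side supply the gradient of the quadratic form. -/
theorem IsCalibration.loopMul_mem {T : ℂ⟦X⟧} (h : IsCalibration T) {F : Potential}
    {f : LoopSpace} (hf : f ∈ cone F) :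
    loopMul (PowerSeries.evalNegHom T) f ∈ cone (transform T F) := by
  obtain ⟨N, t, hN, ht, hq, hp⟩ := mem_cone_iff.mp hf
  set S := PowerSeries.evalNegHom T with hSdef
  have hS : IsCalibration S := h.evalNegHom
  have hTS : T * S = 1 := by rw [mul_comm, h.symplectic]
  have hz : ∀ i, N ≤ i → shift t i = 0 := fun i => ht.shift_eq_zero hN
  have ht' := hS.isPoint_subst hN ht
  have hs' := shift_subst_linearPart S hN ht
  set t' := fun j => subst t (linearPart S j)
  have hback : (fun j => subst t' (linearPart T j)) = t := by
    refine shift_injective (funext fun j => ?_)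
    rw [shift_subst_linearPart T hN ht' j]
    simp only [hs']
    rw [sum_coeff_mul_sum_coeff_mul T S (shift t) j hz, hTS, sum_C_coeff_one_mul _ _ hz]
  refine mem_cone_iff.mpr ⟨N, t', hN, ht', fun i => ?_, fun i => ?_⟩
  · rw [coeff_loopMul S f _ N, hs']
    · refine Finset.sum_congr rfl fun k _ => ?_
      rw [← hq]
      push_cast
      ring_nf
    · intro k hk
      rw [show -(i : ℤ) - k = -((i + k : ℕ) : ℤ) by push_cast; ring, hq, hz _ (by omega)]
  · have hsgn : ∀ n, PowerSeries.coeff n S = (-1) ^ n * PowerSeries.coeff n T :=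
      coeff_evalNegHom T
    have e1 : subst t' (subst (linearPart T) (pullbackPd T i F)) =
        ∑ j ∈ Finset.range (i + 1), C (PowerSeries.coeff (i - j) T) * subst t (pd j F) := by
      rw [subst_comp_subst_apply h.hasSubst ht'.hasSubst, hback, pullbackPd,
        ← coe_substAlgHom ht.hasSubst, map_sum]
      exact Finset.sum_congr rfl fun j _ => by rw [map_mul, coe_substAlgHom, subst_C]
    -- The row `W_{i·}` consists of the coefficients of `alternatingTail T i * T`; evaluated at `S
    -- q`, the factor `T` cancels against `S`.
    have e2 : subst t' (gradPart T i) =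
        ∑ n ∈ Finset.range N, C (PowerSeries.coeff n (alternatingTail T i)) * shift t n := by
      rw [gradPart, subst_qsum hN ht']
      have := sum_coeff_mul_sum_coeff_mul (alternatingTail T i * T) S (shift t) 0 hz
      rw [mul_assoc, hTS, mul_one] at this
      simp only [add_zero] at this
      rw [← this]
      refine Finset.sum_congr rfl fun l _ => ?_
      rw [subst_C, hs', mul_comm]
      rfl
    -- The first `i + 1` terms of the product meet the momenta `p`, the following `N` meet the
    -- coordinates `q`.
    rw [h.pd_transform, subst_add ht'.hasSubst, e1, e2, coeff_loopMul S f _ (i + 1 + N),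
      Finset.sum_range_add, mul_add, ← Finset.sum_range_reflect (fun j => C _ * _)]
    · congr 1
      · rw [Finset.mul_sum]
        refine Finset.sum_congr rfl fun k hk => ?_
        have hk' := Finset.mem_range.mp hk
        obtain ⟨d, rfl⟩ : ∃ d, i = k + d := ⟨i - k, by omega⟩
        rw [show k + d + 1 - 1 - k = d by omega, show k + d - k = d by omega,
          show ((k + d : ℕ) : ℤ) + 1 - d = (k : ℤ) + 1 by push_cast; ring, hp, hsgn, map_mul,
          map_pow, map_neg, map_one]
        ring
      · rw [Finset.mul_sum]
        refine Finset.sum_congr rfl fun k _ => ?_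
        rw [show (i : ℤ) + 1 - ((i + 1 + k : ℕ) : ℤ) = -(k : ℤ) by push_cast; ring, hq, hsgn,
          alternatingTail, PowerSeries.coeff_mk, map_mul, map_mul, map_pow, map_pow, map_neg,
          map_one, pow_add _ (i + 1) k]
        ring
    · intro k hk
      rw [show (i : ℤ) + 1 - k = -((k - (i + 1) : ℕ) : ℤ) by omega, hq, hz _ (by omega)]

/-- Above every formal point there is a point of the graph. -/
theorem exists_mem_cone (F : Potential) {N : ℕ} (hN : 2 ≤ N) {t : ℕ → PointRing}
    (ht : IsPoint N t) : ∃ f ∈ cone F, ∀ i : ℕ, f.coeff (-(i : ℤ)) = shift t i := by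
  let c : ℤ → PointRing := fun n =>
    if n ≤ 0 then shift t (-n).toNat else (-1) ^ n.toNat * subst t (pd (n - 1).toNat F)
  have hc : BddBelow (Function.support c) := by
    refine ⟨-(N : ℤ), fun n hn => ?_⟩
    by_contra hlt
    refine hn ?_
    simp only [c]
    rw [if_pos (by omega), ht.shift_eq_zero hN (by omega)]
  have hq : ∀ i : ℕ, (HahnSeries.ofSuppBddBelow c hc).coeff (-(i : ℤ)) = shift t i := by
    intro i
    simp [c]
  refine ⟨HahnSeries.ofSuppBddBelow c hc, mem_cone_iff.mpr ⟨N, t, hN, ht, hq, fun i => ?_⟩, hq⟩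
  rw [HahnSeries.coeff_ofSuppBddBelow]
  simp only [c]
  rw [if_neg (by omega), show ((i : ℤ) + 1).toNat = i + 1 by omega,
    show ((i : ℤ) + 1 - 1).toNat = i by omega]

/-- The graph of `dF` determines `F` by the dilaton equation. -/
theorem eq_of_cone_subset {F G : Potential} (hF : DilatonEq F) (hG : DilatonEq G)
    (h : cone F ⊆ cone G) : F = G := by
  have hpd : ∀ i, pd i F = pd i G := by
    intro i
    refine ext_genericPoint fun N hN => ?_
    have ht := isPoint_genericPoint N
    obtain ⟨f, hf, hft⟩ := exists_mem_cone F hN ht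
    obtain ⟨_, t, _, _, hq, hp⟩ := mem_cone_iff.mp hf
    obtain ⟨_, u, _, _, hq', hp'⟩ := mem_cone_iff.mp (h hf)
    obtain rfl : t = genericPoint N := shift_injective (funext fun j => by rw [← hq, hft])
    obtain rfl : u = genericPoint N := shift_injective (funext fun j => by rw [← hq', hft])
    have := (hp i).symm.trans (hp' i)
    exact (IsUnit.mul_right_inj ((isUnit_one.neg).pow _)).mp this
  rw [dilatonEq_iff] at hF hG
  simp only [hpd, hG] at hF
  have h2 : (2 : Potential) = C 2 := (map_ofNat C 2).symm
  rw [h2] at hF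
  have := congrArg (C (1 / 2 : ℂ) * ·) hF
  simp only [← mul_assoc, ← map_mul] at this
  norm_num at this
  exact this.symm

theorem IsCalibration.translate_cone {T : ℂ⟦X⟧} (h : IsCalibration T) {F : Potential}
    (hF : F ∈ GW₀) :
    translate (PowerSeries.evalNegHom T) (cone F) = cone (transform T F) := by
  have hS := h.evalNegHom
  -- The two transforms are inverse because multiplying by `S` and then by `T` fixes every point of
  -- the cone, and the cone determines the potential.
  have hinv : transform (PowerSeries.evalNegHom T) (transform T F) = F := by
    refine (eq_of_cone_subset hF.1 (hS.transform_mem (h.transform_mem hF)).1 fun f hf => ?_).symm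
    have := hS.loopMul_mem (h.loopMul_mem hf)
    rwa [loopMul_loopMul, evalNegHom_evalNegHom, mul_comm, h.symplectic, loopMul_one] at this
  rw [translate_eq]
  refine Set.Subset.antisymm (Set.image_subset_iff.mpr fun f hf => h.loopMul_mem hf) fun g hg => ?_
  have := hS.loopMul_mem hg
  rw [hinv, evalNegHom_evalNegHom] at this
  exact ⟨_, this, by rw [loopMul_loopMul, h.symplectic, loopMul_one]⟩

theorem isCalibration_of_mem {S : (ℂ⟦X⟧)ˣ} (hS : S ∈ GMinus)
    (h1 : PowerSeries.coeff 1 (S : ℂ⟦X⟧) = 0) : IsCalibration (S : ℂ⟦X⟧) where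
  coeff_zero := by rw [PowerSeries.coeff_zero_eq_constantCoeff_apply]; exact hS.1
  coeff_one := h1
  symplectic := hS.2

theorem existsUnique_translate_cone {S : (ℂ⟦X⟧)ˣ} (hS : S ∈ GMinus)
    (h1 : PowerSeries.coeff 1 (S : ℂ⟦X⟧) = 0) {F : Potential} (hF : F ∈ GW₀) :
    ∃! F' : Potential, F' ∈ GW₀ ∧ translate S (cone F) = cone F' := by
  have h := (isCalibration_of_mem hS h1).evalNegHom
  have ht := h.translate_cone hF
  rw [evalNegHom_evalNegHom] at ht
  refine ⟨transform (PowerSeries.evalNegHom S) F, ⟨h.transform_mem hF, ht⟩, ?_⟩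
  rintro G ⟨hG, hGt⟩
  exact eq_of_cone_subset hG.1 (h.transform_mem hF).1 (by rw [← ht, hGt])

end

end GenusZero

/-! ### Rigidity: the string operator and the values of derivatives at the origin -/

namespace GenusZero

noncomputable section

open MvPowerSeries

/-- The string operator `∑ᵢ q_{i+1} ∂ᵢ`. -/
def stringOp (F : Potential) : Potential := qsum 1 fun i => pd i F

/-- The partial derivative `∂_{k-1}`, where `∂_{-1} = 0`. -/
def pdPred (k : ℕ) (F : Potential) : Potential := if 1 ≤ k then pd (k - 1) F else 0

theorem pdPred_zero (F : Potential) : pdPred 0 F = 0 := by simp [pdPred]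

theorem pdPred_succ (k : ℕ) (F : Potential) : pdPred (k + 1) F = pd k F := by simp [pdPred]

/-- The commutator of `∂_k` with the string field is `∂_{k-1}`; this index shift drives all later
inductions. -/
theorem stringOp_pd (k : ℕ) (F : Potential) :
    stringOp (pd k F) = pd k (stringOp F) - pdPred k F := by
  rw [stringOp, stringOp, pd_qsum, pdPred]
  simp only [pd_comm k]
  ring

theorem stringOp_add (F G : Potential) : stringOp (F + G) = stringOp F + stringOp G := by
  simp only [stringOp, pd_add, qsum_add]

theorem stringOp_mul (F G : Potential) :
    stringOp (F * G) = F * stringOp G + G * stringOp F := by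
  simp only [stringOp, pd_mul, qsum_add, qsum_mul]

theorem stringOp_C_mul (c : ℂ) (F : Potential) : stringOp (C c * F) = C c * stringOp F := by
  simp only [stringOp, pd_C_mul, qsum_mul]

theorem stringOp_sub (F G : Potential) : stringOp (F - G) = stringOp F - stringOp G := by
  have : F - G = F + C (-1) * G := by rw [map_neg, map_one]; ring
  rw [this, stringOp_add, stringOp_C_mul, map_neg, map_one]
  ring

/-- At the origin only `q₁ = -1` survives, so the string operator acts there as `-∂₀`. -/
theorem constantCoeff_stringOp (F : Potential) :
    constantCoeff (stringOp F) = -constantCoeff (pd 0 F) := by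
  rw [stringOp, constantCoeff_qsum 1 le_rfl]

/-- All coefficients of degree less than `n` vanish. -/
def VanishesBelow (n : ℕ) (F : Potential) : Prop := ∀ m : ℕ →₀ ℕ, m.degree < n → coeff m F = 0

namespace VanishesBelow

variable {n : ℕ} {F G : Potential}

theorem mono {k : ℕ} (h : VanishesBelow n F) (hk : k ≤ n) : VanishesBelow k F :=
  fun m hm => h m (hm.trans_le hk)

theorem constantCoeff_eq (h : VanishesBelow n F) (hn : 0 < n) : constantCoeff F = 0 := by
  rw [← coeff_zero_eq_constantCoeff_apply]
  exact h 0 (by simpa using hn)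

theorem add (hF : VanishesBelow n F) (hG : VanishesBelow n G) : VanishesBelow n (F + G) :=
  fun m hm => by rw [map_add, hF m hm, hG m hm, add_zero]

theorem mul_left (G : Potential) (hF : VanishesBelow n F) : VanishesBelow n (G * F) := by
  classical
  intro m hm
  rw [coeff_mul]
  refine Finset.sum_eq_zero fun ij hij => ?_
  rw [hF, mul_zero]
  have := congrArg Finsupp.degree (Finset.HasAntidiagonal.mem_antidiagonal.mp hij)
  rw [map_add] at this
  omega

theorem pd (h : VanishesBelow (n + 1) F) (i : ℕ) : VanishesBelow n (pd i F) := by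
  intro m hm
  rw [coeff_pd, h, zero_mul]
  rw [map_add, Finsupp.degree_single]
  omega

theorem of_pd (h0 : constantCoeff F = 0) (h : ∀ i, VanishesBelow n (GenusZero.pd i F)) :
    VanishesBelow (n + 1) F := by
  intro m hm
  rcases eq_or_ne m 0 with rfl | hm0
  · rw [coeff_zero_eq_constantCoeff_apply, h0]
  · obtain ⟨i, hi⟩ := Finsupp.ne_iff.mp hm0
    have hle : Finsupp.single i 1 ≤ m := by
      rw [Finsupp.single_le_iff]
      exact Nat.one_le_iff_ne_zero.mpr hi
    obtain ⟨μ, rfl⟩ := exists_add_of_le hle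
    have h1 := h i μ (by rw [map_add, Finsupp.degree_single] at hm; omega)
    rw [coeff_pd, mul_eq_zero] at h1
    rw [add_comm]
    exact h1.resolve_right (Nat.cast_add_one_ne_zero _)

/-- The string equation determines the derivative `∂₀F` up to terms of the degree of `F`. -/
theorem pd_zero_of_stringOp (h : VanishesBelow n F) (hs : VanishesBelow n (stringOp F)) :
    VanishesBelow n (GenusZero.pd 0 F) := by
  classical
  intro m hm
  have h1 := hs m hm
  -- The `-1` in `q₁ = t₁ - 1` isolates `∂₀F`; every other term has the form `t_{i+1} ∂ᵢF`, which
  -- cannot lower the degree.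
  rw [stringOp, coeff_qsum, finsum_eq_single _ 0] at h1
  · have hq : q (0 + 1) = X 1 - 1 := by simp [q]
    rw [hq, sub_mul, one_mul, map_sub, sub_eq_zero] at h1
    rw [← h1, MvPowerSeries.X, coeff_monomial_mul]
    split_ifs with hle
    · obtain ⟨μ, rfl⟩ := exists_add_of_le hle
      rw [add_tsub_cancel_left, coeff_pd, h, zero_mul, mul_zero]
      rw [map_add, Finsupp.degree_single] at hm ⊢
      omega
    · rfl
  · intro i hi
    have hq : q (i + 1) = X (i + 1) := by simp [q, hi]
    rw [hq, MvPowerSeries.X, coeff_monomial_mul]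
    split_ifs with hle
    · obtain ⟨μ, rfl⟩ := exists_add_of_le hle
      rw [add_tsub_cancel_left, coeff_pd, h, zero_mul, mul_zero]
      rw [map_add, Finsupp.degree_single] at hm ⊢
      omega
    · rfl

end VanishesBelow

theorem eq_zero_of_vanishesBelow {F : Potential} (h : ∀ n, VanishesBelow n F) : F = 0 := by
  ext m
  exact h (m.degree + 1) m (Nat.lt_succ_self _)

/-! ### The constants of a theory -/

/-- The series `1 + ∑ (∂ₖF)(0) X^{k+2}`. -/
def calibration (F : Potential) : ℂ⟦X⟧ :=
  PowerSeries.mk fun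
    | 0 => 1
    | 1 => 0
    | k + 2 => constantCoeff (pd k F)

theorem q_zero : q 0 = X 0 := by simp [q]

theorem StringEq.stringOp_eq {F : Potential} (h : StringEq F) :
    stringOp F = C (-(1 / 2 : ℂ)) * X 0 ^ 2 := by
  rw [stringOp, (stringEq_iff F).mp h, q_zero]

theorem pd_X (k i : ℕ) : pd k (X i) = if i = k then 1 else 0 := by
  rw [pd, pderiv_X, Pi.single_apply]

theorem StringEq.pd_stringOp {F : Potential} (h : StringEq F) (k : ℕ) :
    pd k (stringOp F) = if 0 = k then -X 0 else 0 := by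
  have h2 : (C (-(1 / 2) : ℂ) : Potential) * 2 = -1 := by
    rw [show (2 : Potential) = C 2 from (map_ofNat C 2).symm, ← map_mul]
    norm_num
  rw [h.stringOp_eq, pd_C_mul, sq, pd_mul, pd_X]
  split_ifs
  · linear_combination X 0 * h2
  · ring

theorem StringEq.pd_pd_stringOp {F : Potential} (h : StringEq F) (k l : ℕ) :
    pd k (pd l (stringOp F)) = if 0 = k ∧ 0 = l then -1 else 0 := by
  rw [h.pd_stringOp]
  by_cases hl : 0 = l
  · rw [if_pos hl, ← zero_sub, pd_sub, pd_X, GenusZero.pd_zero]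
    split_ifs <;> simp_all
  · rw [if_neg hl, GenusZero.pd_zero, if_neg (fun h => hl h.2)]

section

variable {F : Potential}

theorem StringEq.constantCoeff_pd_pd_zero (h : StringEq F) (k : ℕ) :
    constantCoeff (pd k (pd 0 F)) = PowerSeries.coeff (k + 1) (calibration F) := by
  have h1 := congrArg constantCoeff (stringOp_pd k F)
  rw [constantCoeff_stringOp, h.pd_stringOp, map_sub] at h1
  rw [pd_comm, ← neg_neg (constantCoeff (pd 0 (pd k F))), h1]
  cases k with
  | zero => simp [pdPred_zero, calibration]
  | succ k => simp [pdPred_succ, calibration]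

theorem StringEq.constantCoeff_pd_pd_pd_zero (h : StringEq F) (k l : ℕ) :
    constantCoeff (pd 0 (pd k (pd l F))) = constantCoeff (pd k (pdPred l F)) +
      constantCoeff (pdPred k (pd l F)) + if 0 = k ∧ 0 = l then 1 else 0 := by
  have h1 := congrArg constantCoeff (stringOp_pd k (pd l F))
  rw [constantCoeff_stringOp, stringOp_pd, pd_sub, h.pd_pd_stringOp, map_sub, map_sub] at h1
  split_ifs at h1 ⊢ <;> simp only [map_neg, map_one, map_zero] at h1 <;> linear_combination -h1

/-- Both sides compute `∂₀ ∂_{k+1} ∂_{l+1} F` at the origin: the string equation gives the sum, and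
two recursion relations with `∂₀³F(0) = 1` give the product. -/
theorem constantCoeff_pd_pd_add (hs : StringEq F) (ht : TRR F) (k l : ℕ) :
    constantCoeff (pd k (pd (l + 1) F)) + constantCoeff (pd (k + 1) (pd l F)) =
      PowerSeries.coeff (k + 1) (calibration F) * PowerSeries.coeff (l + 1) (calibration F) := by
  have h0 : constantCoeff (pd 0 (pd 0 (pd 0 F))) = 1 := by
    simp [hs.constantCoeff_pd_pd_pd_zero, pdPred_zero, GenusZero.pd_zero]
  have h1 := hs.constantCoeff_pd_pd_pd_zero (k + 1) (l + 1)
  rw [pdPred_succ, pdPred_succ, if_neg (by omega), add_zero] at h1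
  have h2 : pd 0 (pd (k + 1) (pd (l + 1) F)) =
      pd k (pd 0 F) * (pd l (pd 0 F) * pd 0 (pd 0 (pd 0 F))) := by
    rw [pd_comm 0 (k + 1), ht, pd_comm 0 (l + 1), pd_comm 0 (l + 1), ht]
  rw [h2, map_mul, map_mul, h0, hs.constantCoeff_pd_pd_zero, hs.constantCoeff_pd_pd_zero] at h1
  linear_combination -h1

theorem constantCoeff_pd_pd (hs : StringEq F) (ht : TRR F) (k l : ℕ) :
    constantCoeff (pd k (pd l F)) = pairing (calibration F) k l := by
  induction l generalizing k with
  | zero => rw [hs.constantCoeff_pd_pd_zero, pairing_zero_right]; simp [calibration]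
  | succ l ih =>
    rw [pairing_succ_right, ← ih, ← constantCoeff_pd_pd_add hs ht]
    ring

theorem isCalibration_calibration (hs : StringEq F) (ht : TRR F) :
    IsCalibration (calibration F) where
  coeff_zero := by simp [calibration]
  coeff_one := by simp [calibration]
  -- The coefficient of `X^{n+1}` says `W_{0n} = T_{n+1}`, which is the symmetry of `∂₀ ∂ₙ F` at the
  -- origin.
  symplectic := by
    ext n
    rw [evalNegHom_eq (by simp [calibration]), sub_mul, one_mul, mul_assoc]
    cases n with
    | zero => simp [calibration]
    | succ n =>
      rw [map_sub, PowerSeries.coeff_succ_X_mul, PowerSeries.coeff_one, if_neg (by omega),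
        ← hs.constantCoeff_pd_pd_zero, pd_comm, constantCoeff_pd_pd hs ht, pairing, sub_self]

theorem DilatonEq.constantCoeff_eq (h : DilatonEq F) :
    2 * constantCoeff F = -constantCoeff (pd 1 F) := by
  have := congrArg constantCoeff ((dilatonEq_iff F).mp h)
  rw [constantCoeff_qsum 0 (by omega), map_mul, map_ofNat] at this
  exact this.symm

end

/-- A theory is determined by the linear terms of its potential. -/
theorem eq_of_constantCoeff_pd_eq {F G : Potential} (hF : F ∈ GW₀) (hG : G ∈ GW₀)
    (h : ∀ k, constantCoeff (pd k F) = constantCoeff (pd k G)) : F = G := by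
  obtain ⟨hFd, hFs, hFt⟩ := hF
  obtain ⟨hGd, hGs, hGt⟩ := hG
  have hcal : calibration F = calibration G := by
    ext n
    match n with
    | 0 => simp [calibration]
    | 1 => simp [calibration]
    | n + 2 => simp [calibration, h]
  have hstr : stringOp (F - G) = 0 := by
    rw [stringOp_sub, hFs.stringOp_eq, hGs.stringOp_eq, sub_self]
  have h0 : constantCoeff (F - G) = 0 := by
    have e1 := hFd.constantCoeff_eq
    have e2 := hGd.constantCoeff_eq
    rw [h] at e1
    rw [map_sub]
    linear_combination (1 / 2) * e1 - (1 / 2) * e2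
  have h1 : ∀ k, constantCoeff (pd k (F - G)) = 0 := fun k => by rw [pd_sub, map_sub, h, sub_self]
  have h2 : ∀ k l, constantCoeff (pd k (pd l (F - G))) = 0 := fun k l => by
    rw [pd_sub, pd_sub, map_sub, constantCoeff_pd_pd hFs hFt, constantCoeff_pd_pd hGs hGt, hcal,
      sub_self]
  have base : ∀ H : Potential, VanishesBelow 0 H := fun H m hm => absurd hm (Nat.not_lt_zero _)
  -- The string equation carries vanishing of `F - G` below a degree over to `∂₀(F - G)`. The
  -- difference of the recursion relations then controls third derivatives with an index `k + 1`, so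
  -- integrating three times gains one degree.
  have step : ∀ n, VanishesBelow (n + 3) (F - G) := by
    intro n
    induction n with
    | zero =>
      exact .of_pd h0 fun k => .of_pd (h1 k) fun l => .of_pd (h2 l k) fun m => base _
    | succ n ih =>
      have hz : VanishesBelow (n + 3) (pd 0 (F - G)) :=
        ih.pd_zero_of_stringOp (by rw [hstr]; intro m _; simp)
      refine .of_pd h0 fun i => ?_
      cases i with
      | zero => exact hz
      | succ k =>
        refine .of_pd (h1 _) fun l => .of_pd (h2 _ _) fun m => ?_
        have e : pd m (pd l (pd (k + 1) (F - G))) =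
            pd k (pd 0 F) * pd m (pd l (pd 0 (F - G))) +
              pd 0 (pd m (pd l G)) * pd k (pd 0 (F - G)) := by
          have c : ∀ H, pd m (pd l (pd (k + 1) H)) = pd (k + 1) (pd m (pd l H)) := fun H => by
            rw [pd_comm l, pd_comm m]
          have c' : ∀ H, pd m (pd l (pd 0 H)) = pd 0 (pd m (pd l H)) := fun H => by
            rw [pd_comm l, pd_comm m]
          rw [c, c']
          simp only [pd_sub]
          rw [hFt, hGt]
          ring
        rw [e]
        exact ((hz.pd l).pd m).mul_left _ |>.add (((hz.pd k).mono (by omega)).mul_left _)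
  refine sub_eq_zero.mp (eq_zero_of_vanishesBelow fun n => (step n).mono (by omega))

end

end GenusZero

/-! ### The point potential satisfies the three equations -/

namespace GenusZero

noncomputable section

open MvPowerSeries

/-- The number `∏ᵢ (i!)^{mᵢ} mᵢ!`. -/
def symmetryFactor (m : ℕ →₀ ℕ) : ℂ := m.prod fun i k => (i.factorial : ℂ) ^ k * k.factorial

theorem symmetryFactor_ne_zero (m : ℕ →₀ ℕ) : symmetryFactor m ≠ 0 :=
  Finset.prod_ne_zero_iff.mpr fun i _ =>
    mul_ne_zero (pow_ne_zero _ (Nat.cast_ne_zero.mpr i.factorial_ne_zero))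
      (Nat.cast_ne_zero.mpr (Nat.factorial_ne_zero _))

theorem symmetryFactor_add_single (m : ℕ →₀ ℕ) (i : ℕ) :
    symmetryFactor (m + Finsupp.single i 1) = symmetryFactor m * i.factorial * (m i + 1) := by
  have h := Finsupp.mul_prod_erase' (m + Finsupp.single i 1) i
    (fun i k => (i.factorial : ℂ) ^ k * k.factorial) (by simp)
  have h' := Finsupp.mul_prod_erase' m i (fun i k => (i.factorial : ℂ) ^ k * k.factorial) (by simp)
  have he : (m + Finsupp.single i 1).erase i = m.erase i := by simp
  rw [symmetryFactor, symmetryFactor, ← h, ← h', he, Finsupp.add_apply, Finsupp.single_eq_same,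
    Nat.factorial_succ, pow_succ]
  push_cast
  ring

/-- The cohomological degree `∑ i mᵢ` of a monomial. -/
def psiDegree (m : ℕ →₀ ℕ) : ℕ := m.sum fun i k => k * i

theorem psiDegree_add (m m' : ℕ →₀ ℕ) : psiDegree (m + m') = psiDegree m + psiDegree m' :=
  Finsupp.sum_add_index' (by simp) (by intros; ring)

theorem psiDegree_single (i : ℕ) : psiDegree (Finsupp.single i 1) = i := by simp [psiDegree]

theorem coeff_pointPotential (m : ℕ →₀ ℕ) : coeff m pointPotential =
    if psiDegree m + 3 = m.degree then ((m.degree - 3).factorial : ℂ) / symmetryFactor m else 0 := by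
  change psiIntegral m / _ = _
  rw [psiIntegral, symmetryFactor, Finsupp.prod_mul, ite_div, div_div, zero_div]
  rfl

theorem coeff_pd_pointPotential (i : ℕ) (m : ℕ →₀ ℕ) : coeff m (pd i pointPotential) =
    if psiDegree m + i + 2 = m.degree then
      ((m.degree - 2).factorial : ℂ) / (symmetryFactor m * i.factorial) else 0 := by
  rw [coeff_pd, coeff_pointPotential, psiDegree_add, psiDegree_single, map_add,
    Finsupp.degree_single, symmetryFactor_add_single]
  have h1 := symmetryFactor_ne_zero m
  have h2 : (i.factorial : ℂ) ≠ 0 := Nat.cast_ne_zero.mpr i.factorial_ne_zero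
  have h3 : (m i : ℂ) + 1 ≠ 0 := Nat.cast_add_one_ne_zero _
  by_cases h : psiDegree m + i + 2 = m.degree
  · rw [if_pos h, if_pos (by omega), show m.degree + 1 - 3 = m.degree - 2 by omega]
    field_simp
  · rw [if_neg h, if_neg (by omega), zero_mul]

/-- All terms of the dilaton and string sums get the same factor, depending only on `m`. The
remaining weight is `mᵢ` for dilaton and `(i+1) m_{i+1}` for string, so the sums become the degree
and `psiDegree`. -/
theorem coeff_X_mul_pd_pointPotential (j i : ℕ) (m : ℕ →₀ ℕ) :
    coeff m (X j * pd i pointPotential) =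
      if psiDegree m + i + 3 = m.degree + j then
        ((m.degree - 3).factorial : ℂ) / symmetryFactor m * (m j * (j.factorial / i.factorial))
      else 0 := by
  classical
  rw [MvPowerSeries.X, coeff_monomial_mul]
  by_cases hle : Finsupp.single j 1 ≤ m
  · rw [if_pos hle, one_mul]
    obtain ⟨μ, rfl⟩ := exists_add_of_le hle
    have h1 := symmetryFactor_ne_zero μ
    have h2 : (i.factorial : ℂ) ≠ 0 := Nat.cast_ne_zero.mpr i.factorial_ne_zero
    have h2' : (j.factorial : ℂ) ≠ 0 := Nat.cast_ne_zero.mpr j.factorial_ne_zero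
    have h3 : (μ j : ℂ) + 1 ≠ 0 := Nat.cast_add_one_ne_zero _
    rw [add_tsub_cancel_left, coeff_pd_pointPotential, add_comm (Finsupp.single j 1) μ,
      psiDegree_add, psiDegree_single, map_add, Finsupp.degree_single, symmetryFactor_add_single,
      Finsupp.add_apply, Finsupp.single_eq_same]
    by_cases h : psiDegree μ + i + 2 = μ.degree
    · rw [if_pos h, if_pos (by omega), show μ.degree + 1 - 3 = μ.degree - 2 by omega]
      push_cast
      field_simp
    · rw [if_neg h, if_neg (by omega)]
  · have : m j = 0 := by
      rw [Finsupp.single_le_iff] at hle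
      omega
    rw [if_neg hle, this]
    simp

theorem sum_range_eq_degree {N : ℕ} {m : ℕ →₀ ℕ} (hm : ∀ i, N ≤ i → m i = 0) :
    ∑ i ∈ Finset.range N, m i = m.degree := by
  rw [Finsupp.degree]
  refine (Finset.sum_subset (fun i hi => ?_) (fun i _ hi => Finsupp.notMem_support_iff.mp hi)).symm
  by_contra h
  exact (Finsupp.mem_support_iff.mp hi) (hm i (by simpa using h))

theorem sum_range_eq_psiDegree {N : ℕ} {m : ℕ →₀ ℕ} (hm : ∀ i, N ≤ i → m i = 0) :
    ∑ i ∈ Finset.range N, m i * i = psiDegree m := by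
  rw [psiDegree, Finsupp.sum]
  refine (Finset.sum_subset (fun i hi => ?_) (fun i _ hi => ?_)).symm
  · by_contra h
    exact (Finsupp.mem_support_iff.mp hi) (hm i (by simpa using h))
  · rw [Finsupp.notMem_support_iff.mp hi, zero_mul]

theorem dilatonEq_pointPotential : DilatonEq pointPotential := by
  rw [dilatonEq_iff]
  ext m
  obtain ⟨N, hN, hm⟩ := exists_forall_le_eq_zero m
  rw [coeff_qsum_eq_sum hN hm]
  have hsplit : ∀ i, coeff m (q (i + 0) * pd i pointPotential) =
      coeff m (X i * pd i pointPotential) -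
        if i = 1 then coeff m (pd 1 pointPotential) else 0 := by
    intro i
    rw [q, add_zero, sub_mul, map_sub]
    split_ifs with h
    · rw [one_mul, h]
    · simp
  have h1 : (1 : ℕ) ∈ Finset.range N := Finset.mem_range.mpr (by omega)
  simp only [hsplit, Finset.sum_sub_distrib, Finset.sum_ite_eq', h1, if_true]
  rw [show (2 : Potential) = C 2 from (map_ofNat C 2).symm, coeff_C_mul, coeff_pointPotential,
    coeff_pd_pointPotential]
  simp only [coeff_X_mul_pd_pointPotential]
  by_cases h : psiDegree m + 3 = m.degree
  · rw [if_pos h, if_pos (by omega)]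
    have : ∀ i ∈ Finset.range N, (if psiDegree m + i + 3 = m.degree + i then
        ((m.degree - 3).factorial : ℂ) / symmetryFactor m * (m i * (i.factorial / i.factorial))
        else 0) = ((m.degree - 3).factorial : ℂ) / symmetryFactor m * m i := by
      intro i _
      rw [if_pos (by omega), div_self (Nat.cast_ne_zero.mpr i.factorial_ne_zero), mul_one]
    rw [Finset.sum_congr rfl this, ← Finset.mul_sum, ← Nat.cast_sum, sum_range_eq_degree hm, ← h,
      show psiDegree m + 3 - 2 = psiDegree m + 1 by omega, Nat.add_sub_cancel, Nat.factorial_succ]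
    have := symmetryFactor_ne_zero m
    push_cast
    field_simp
    ring
  · rw [if_neg h, if_neg (by omega), Finset.sum_eq_zero]
    · simp
    · intro i _
      rw [if_neg (by omega)]

theorem coeff_X_zero_sq (m : ℕ →₀ ℕ) :
    coeff m ((X 0 : Potential) ^ 2) = if m = Finsupp.single 0 2 then 1 else 0 := by
  classical
  rw [coeff_X_pow]

theorem stringEq_pointPotential : StringEq pointPotential := by
  rw [stringEq_iff]
  ext m
  obtain ⟨N, hN, hm⟩ := exists_forall_le_eq_zero m
  rw [coeff_qsum_eq_sum hN hm, q_zero]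
  have hsplit : ∀ i, coeff m (q (i + 1) * pd i pointPotential) =
      coeff m (X (i + 1) * pd i pointPotential) -
        if i = 0 then coeff m (pd 0 pointPotential) else 0 := by
    intro i
    rw [q, sub_mul, map_sub]
    by_cases h : i = 0
    · simp [h]
    · simp [h]
  have h0 : (0 : ℕ) ∈ Finset.range N := Finset.mem_range.mpr (by omega)
  simp only [hsplit, Finset.sum_sub_distrib, Finset.sum_ite_eq', h0, if_true]
  rw [coeff_C_mul, coeff_X_zero_sq, coeff_pd_pointPotential]
  simp only [coeff_X_mul_pd_pointPotential]
  by_cases h : psiDegree m + 2 = m.degree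
  · rw [if_pos (by omega)]
    have : ∀ i ∈ Finset.range N, (if psiDegree m + i + 3 = m.degree + (i + 1) then
        ((m.degree - 3).factorial : ℂ) / symmetryFactor m *
          (m (i + 1) * ((i + 1).factorial / i.factorial)) else 0) =
        ((m.degree - 3).factorial : ℂ) / symmetryFactor m * ((m (i + 1) * (i + 1) : ℕ) : ℂ) := by
      intro i _
      have : (i.factorial : ℂ) ≠ 0 := Nat.cast_ne_zero.mpr i.factorial_ne_zero
      rw [if_pos (by omega), Nat.factorial_succ]
      push_cast
      field_simp
    have hps : ∑ i ∈ Finset.range N, m (i + 1) * (i + 1) = psiDegree m := by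
      have := Finset.sum_range_succ' (fun i => m i * i) N
      rw [mul_zero, add_zero] at this
      rw [← this]
      exact sum_range_eq_psiDegree fun i hi => hm i (by omega)
    rw [Finset.sum_congr rfl this, ← Finset.mul_sum, ← Nat.cast_sum, hps]
    have hsym := symmetryFactor_ne_zero m
    -- If `psiDegree m > 0`, the sum cancels the coefficient of `∂₀F`. The value zero forces the
    -- monomial `t₀²`, which produces the right-hand side.
    rcases Nat.eq_zero_or_pos (psiDegree m) with hz | hpos
    · have hm2 : m = Finsupp.single 0 2 := by
        have hz' : ∀ i, i ≠ 0 → m i = 0 := by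
          intro i hi
          by_contra hne
          have := Finset.sum_eq_zero_iff.mp hz i (Finsupp.mem_support_iff.mpr hne)
          exact (Nat.mul_ne_zero hne hi) this
        have : m = Finsupp.single 0 (m 0) := by
          ext i
          rcases eq_or_ne i 0 with rfl | hi
          · simp
          · rw [hz' i hi, Finsupp.single_eq_of_ne hi]
        rw [this, Finsupp.degree_single] at h
        rw [this, ← h]
        congr 1
        rw [← this, hz]
      rw [hz, if_pos hm2, hm2]
      simp [symmetryFactor]
    · have hm2 : m ≠ Finsupp.single 0 2 := by
        rintro rfl
        simp [psiDegree] at hpos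
      rw [if_neg hm2, ← h, Nat.add_sub_cancel,
        show psiDegree m = (psiDegree m - 1) + 1 by omega, Nat.factorial_succ]
      simp
      field_simp
      simp
  · have hm2 : m ≠ Finsupp.single 0 2 := by
      rintro rfl
      simp [psiDegree] at h
    rw [if_neg (by omega), if_neg hm2, Finset.sum_eq_zero]
    · simp
    · intro i _
      rw [if_neg (by omega)]

/-- The degree of a monomial, where `tᵢ` has degree `1 - i`. -/
def dimension (m : ℕ →₀ ℕ) : ℤ := m.degree - psiDegree m

theorem dimension_add (m m' : ℕ →₀ ℕ) : dimension (m + m') = dimension m + dimension m' := by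
  simp only [dimension, map_add, psiDegree_add]
  push_cast
  ring

/-- Homogeneity of degree `w`, where `tᵢ` has degree `1 - i`. -/
def IsHomogeneousOfDimension (w : ℤ) (F : Potential) : Prop :=
  ∀ m, coeff m F ≠ 0 → dimension m = w

namespace IsHomogeneousOfDimension

variable {v w : ℤ} {F G : Potential}

theorem pd (h : IsHomogeneousOfDimension w F) (i : ℕ) :
    IsHomogeneousOfDimension (w - 1 + i) (pd i F) := by
  intro m hm
  rw [coeff_pd] at hm
  have := h _ (left_ne_zero_of_mul hm)
  rw [dimension_add] at this
  have h1 : dimension (Finsupp.single i 1) = 1 - i := by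
    simp [dimension, psiDegree_single]
  rw [h1] at this
  linarith

theorem sub (hF : IsHomogeneousOfDimension w F) (hG : IsHomogeneousOfDimension w G) :
    IsHomogeneousOfDimension w (F - G) := by
  intro m hm
  by_cases h : coeff m F = 0
  · refine hG m fun h' => hm ?_
    rw [map_sub, h, h', sub_zero]
  · exact hF m h

theorem mul (hF : IsHomogeneousOfDimension v F) (hG : IsHomogeneousOfDimension w G) :
    IsHomogeneousOfDimension (v + w) (F * G) := by
  classical
  intro m hm
  rw [coeff_mul] at hm
  obtain ⟨ij, hij, hne⟩ := Finset.exists_ne_zero_of_sum_ne_zero hm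
  rw [← Finset.HasAntidiagonal.mem_antidiagonal.mp hij, dimension_add,
    hF _ (left_ne_zero_of_mul hne), hG _ (right_ne_zero_of_mul hne)]

/-- A homogeneous function of positive degree annihilated by the string operator vanishes, as each
of its monomials is divisible by `t₀`. -/
theorem eq_zero (hw : 0 < w) (h : IsHomogeneousOfDimension w F) (hs : stringOp F = 0) : F = 0 := by
  refine eq_zero_of_vanishesBelow fun n => ?_
  induction n with
  | zero => exact fun m hm => absurd hm (Nat.not_lt_zero _)
  | succ n ih =>
    have h0 := ih.pd_zero_of_stringOp (by rw [hs]; intro m _; simp)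
    intro m hm
    by_contra hne
    have hdim := h m hne
    have hm0 : m 0 ≠ 0 := by
      intro hm0
      have : m.degree ≤ psiDegree m := by
        refine Finset.sum_le_sum fun i hi => Nat.le_mul_of_pos_right _ (Nat.pos_of_ne_zero ?_)
        rintro rfl
        exact (Finsupp.mem_support_iff.mp hi) hm0
      rw [dimension] at hdim
      omega
    have hle : Finsupp.single 0 1 ≤ m := by
      rw [Finsupp.single_le_iff]
      omega
    obtain ⟨μ, rfl⟩ := exists_add_of_le hle
    have h1 := h0 μ (by rw [map_add, Finsupp.degree_single] at hm; omega)
    rw [coeff_pd, mul_eq_zero, add_comm μ] at h1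
    exact hne (h1.resolve_right (Nat.cast_add_one_ne_zero _))

end IsHomogeneousOfDimension

theorem isHomogeneousOfDimension_pointPotential :
    IsHomogeneousOfDimension 3 pointPotential := by
  intro m hm
  rw [coeff_pointPotential] at hm
  have := (ite_ne_right_iff.mp hm).1
  rw [dimension, ← this]
  push_cast
  ring

/-- The defect of a topological recursion relation. -/
def trrDefect (F : Potential) (k l m : ℕ) : Potential :=
  pd (k + 1) (pd l (pd m F)) - pd k (pd 0 F) * pd 0 (pd l (pd m F))

theorem isHomogeneousOfDimension_trrDefect {F : Potential} (h : IsHomogeneousOfDimension 3 F)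
    (k l m : ℕ) : IsHomogeneousOfDimension (k + l + m + 1) (trrDefect F k l m) := by
  refine .sub ?_ ?_
  · convert ((h.pd m).pd l).pd (k + 1) using 1
    push_cast
    ring
  · convert ((h.pd 0).pd k).mul (((h.pd m).pd l).pd 0) using 1
    push_cast
    ring

/-- Each commutator lowers one index. When `k = 0`, the constant from differentiating `-q₀²/2`
cancels the term in which `∂₁` becomes `∂₀`. -/
theorem StringEq.stringOp_trrDefect {F : Potential} (h : StringEq F) (k l m : ℕ) :
    stringOp (trrDefect F k l m) =
      -((if 1 ≤ k then trrDefect F (k - 1) l m else 0) +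
        (if 1 ≤ l then trrDefect F k (l - 1) m else 0) +
        if 1 ≤ m then trrDefect F k l (m - 1) else 0) := by
  have h3 : ∀ a b c, pd a (pd b (pd c (stringOp F))) = 0 := by
    intro a b c
    rw [h.pd_pd_stringOp]
    split_ifs
    · rw [← map_one C, ← map_neg, pd_C]
    · exact GenusZero.pd_zero a
  have e1 : stringOp (pd (k + 1) (pd l (pd m F))) =
      -(pd (k + 1) (pd l (pdPred m F)) + pd (k + 1) (pdPred l (pd m F)) +
        pd k (pd l (pd m F))) := by
    simp only [stringOp_pd, pd_sub, h3, pdPred_succ]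
    ring
  have e2 : stringOp (pd 0 (pd l (pd m F))) =
      -(pd 0 (pd l (pdPred m F)) + pd 0 (pdPred l (pd m F))) := by
    simp only [stringOp_pd, pd_sub, h3, pdPred_zero]
    ring
  have e3 : stringOp (pd k (pd 0 F)) = -(pdPred k (pd 0 F) + if 0 = k then 1 else 0) := by
    simp only [stringOp_pd, pd_sub, h.pd_pd_stringOp, pdPred_zero, GenusZero.pd_zero]
    split_ifs <;> simp_all <;> ring
  rw [trrDefect, stringOp_sub, stringOp_mul, e1, e2, e3]
  cases k <;> cases l <;> cases m <;>
    simp only [pdPred_zero, pdPred_succ, trrDefect, GenusZero.pd_zero, Nat.add_sub_cancel,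
      Nat.le_add_left, if_true, Nat.le_zero_eq, one_ne_zero, if_false, zero_add,
      Nat.zero_ne_add_one] <;> ring

/-- By induction on `k + l + m` the string operator kills the defect, whose degree `k + l + m + 1`
is positive; such a series vanishes. -/
theorem trr_of_stringEq {F : Potential} (hs : StringEq F) (h : IsHomogeneousOfDimension 3 F) :
    TRR F := by
  have key : ∀ n k l m, k + l + m = n → trrDefect F k l m = 0 := by
    intro n
    induction n using Nat.strong_induction_on with
    | _ n ih =>
      intro k l m hn
      refine (isHomogeneousOfDimension_trrDefect h k l m).eq_zero (by positivity) ?_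
      have h1 : (if 1 ≤ k then trrDefect F (k - 1) l m else 0) = 0 := by
        split_ifs
        · exact ih _ (by omega) _ _ _ rfl
        · rfl
      have h2 : (if 1 ≤ l then trrDefect F k (l - 1) m else 0) = 0 := by
        split_ifs
        · exact ih _ (by omega) _ _ _ rfl
        · rfl
      have h3 : (if 1 ≤ m then trrDefect F k l (m - 1) else 0) = 0 := by
        split_ifs
        · exact ih _ (by omega) _ _ _ rfl
        · rfl
      rw [hs.stringOp_trrDefect, h1, h2, h3]
      simp
  exact fun k l m => sub_eq_zero.mp (key _ k l m rfl)

theorem pointPotential_mem : pointPotential ∈ GW₀ :=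
  ⟨dilatonEq_pointPotential, stringEq_pointPotential,
    trr_of_stringEq stringEq_pointPotential isHomogeneousOfDimension_pointPotential⟩

end

end GenusZero

/-! ### Transitivity and the exponential form -/

namespace GenusZero

noncomputable section

open MvPowerSeries

theorem constantCoeff_pd_pointPotential (k : ℕ) : constantCoeff (pd k pointPotential) = 0 := by
  rw [← coeff_zero_eq_constantCoeff_apply, coeff_pd_pointPotential, if_neg]
  rw [map_zero]
  omega

/-- The point potential has no linear terms, so only the quadratic form contributes. Its gradient at
`q = -z` is `-W_{k1}`, and this is `T_{k+2}` because `T₁ = 0`. -/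
theorem IsCalibration.constantCoeff_pd_transform {T : ℂ⟦X⟧} (h : IsCalibration T) (k : ℕ) :
    constantCoeff (pd k (transform T pointPotential)) = PowerSeries.coeff (k + 2) T := by
  have h1 : constantCoeff (pullbackPd T k pointPotential) = 0 := by
    rw [pullbackPd, map_sum]
    exact Finset.sum_eq_zero fun j _ => by
      rw [map_mul, constantCoeff_pd_pointPotential, mul_zero]
  rw [h.pd_transform, map_add,
    constantCoeff_subst_of_constantCoeff_eq_zero h.hasSubst h.constantCoeff_linearPart, h1,
    gradPart, constantCoeff_qsum 0 (by omega), constantCoeff_C, Nat.sub_zero,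
    pairing_succ_right, pairing_zero_right, h.coeff_one, h.coeff_zero]
  ring

theorem eq_transform_pointPotential {F : Potential} (hF : F ∈ GW₀) :
    transform (calibration F) pointPotential = F := by
  have h := isCalibration_calibration hF.2.1 hF.2.2
  refine eq_of_constantCoeff_pd_eq (h.transform_mem pointPotential_mem) hF fun k => ?_
  rw [h.constantCoeff_pd_transform, calibration, PowerSeries.coeff_mk]

/-- The element of `G₋` given by a calibration. -/
def IsCalibration.toUnits {T : ℂ⟦X⟧} (h : IsCalibration T) : (ℂ⟦X⟧)ˣ where
  val := PowerSeries.evalNegHom T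
  inv := T
  val_inv := h.symplectic
  inv_val := by rw [mul_comm, h.symplectic]

theorem IsCalibration.toUnits_mem {T : ℂ⟦X⟧} (h : IsCalibration T) : h.toUnits ∈ GMinus := by
  refine ⟨?_, h.evalNegHom.symplectic⟩
  rw [← PowerSeries.coeff_zero_eq_constantCoeff_apply]
  exact h.evalNegHom.coeff_zero

theorem exists_translate_pointPotential {F : Potential} (hF : F ∈ GW₀) :
    ∃ S ∈ GMinus, PowerSeries.coeff 1 (S : ℂ⟦X⟧) = 0 ∧
      translate S (cone pointPotential) = cone F := by
  have h := isCalibration_calibration hF.2.1 hF.2.2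
  exact ⟨h.toUnits, h.toUnits_mem, h.evalNegHom.coeff_one,
    (h.translate_cone pointPotential_mem).trans (congrArg cone (eq_transform_pointPotential hF))⟩

/-- The logarithm of a power series with constant term one. -/
theorem exists_exp_subst_eq {S : ℂ⟦X⟧} (h0 : PowerSeries.constantCoeff S = 1) :
    ∃ L : ℂ⟦X⟧, PowerSeries.constantCoeff L = 0 ∧
      PowerSeries.derivative ℂ S = PowerSeries.derivative ℂ L * S ∧
      S = (PowerSeries.exp ℂ).subst L := by
  have hS : S⁻¹ * S = 1 := PowerSeries.inv_mul_cancel S (by rw [h0]; exact one_ne_zero)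
  set D := PowerSeries.derivative ℂ S * S⁻¹ with hD
  -- `L` integrates `S'/S`; at `n = 0` division by zero makes the constant term zero.
  let L : ℂ⟦X⟧ := PowerSeries.mk fun n => PowerSeries.coeff (n - 1) D / n
  have hL0 : PowerSeries.constantCoeff L = 0 := by
    rw [← PowerSeries.coeff_zero_eq_constantCoeff_apply]
    simp [L]
  have hLD : PowerSeries.derivative ℂ L = D := by
    ext n
    rw [PowerSeries.coeff_derivative]
    simp only [L, PowerSeries.coeff_mk, Nat.add_sub_cancel, Nat.cast_add, Nat.cast_one]
    exact div_mul_cancel₀ _ (Nat.cast_add_one_ne_zero n)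
  have hsub : PowerSeries.HasSubst L := PowerSeries.HasSubst.of_constantCoeff_zero' hL0
  set E := (PowerSeries.exp ℂ).subst L with hE
  have hdE : PowerSeries.derivative ℂ E = E * D := by
    rw [hE, PowerSeries.derivative_subst hsub, hLD, PowerSeries.derivative_exp]
  have hE0 : PowerSeries.constantCoeff E = 1 := by
    have := constantCoeff_subst_of_constantCoeff_eq_zero (a := fun _ : Unit => L)
      hsub.const (fun _ => hL0) (PowerSeries.exp ℂ)
    exact this.trans PowerSeries.constantCoeff_exp
  have hDS : PowerSeries.derivative ℂ S = D * S := by rw [hD, mul_assoc, hS, mul_one]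
  refine ⟨L, hL0, by rw [hLD, hDS], ?_⟩
  have h1 : S⁻¹ * E = 1 := by
    refine PowerSeries.derivative.ext ?_ ?_
    · rw [Derivation.leibniz, PowerSeries.derivative_inv', hdE, hDS]
      simp only [smul_eq_mul, Derivation.map_one_eq_zero]
      linear_combination (-(E * D * S⁻¹)) * hS
    · rw [map_mul, hE0, mul_one, map_one, PowerSeries.constantCoeff_inv, h0, inv_one]
  calc S = S * (S⁻¹ * E) := by rw [h1, mul_one]
    _ = (S⁻¹ * S) * E := by ring
    _ = E := by rw [hS, one_mul]

theorem derivative_evalNegHom (S : ℂ⟦X⟧) : PowerSeries.derivative ℂ (PowerSeries.evalNegHom S) =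
    -PowerSeries.evalNegHom (PowerSeries.derivative ℂ S) := by
  ext n
  rw [map_neg, PowerSeries.coeff_derivative, coeff_evalNegHom, coeff_evalNegHom,
    PowerSeries.coeff_derivative]
  ring

theorem exists_eq_expOdd {S : (ℂ⟦X⟧)ˣ} (hS : S ∈ GMinus)
    (h1 : PowerSeries.coeff 1 (S : ℂ⟦X⟧) = 0) : ∃ a : ℕ → ℂ, (S : ℂ⟦X⟧) = expOdd a := by
  obtain ⟨L, hL0, hL, hexp⟩ := exists_exp_subst_eq hS.1
  set U : ℂ⟦X⟧ := (S : ℂ⟦X⟧)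
  set V := PowerSeries.evalNegHom U
  have hVU : V * U = 1 := hS.2
  -- Differentiating `S(-z) S(z) = 1` shows that the logarithmic derivative is even; hence `L`,
  -- which has no constant term, is odd.
  have heven : PowerSeries.evalNegHom (PowerSeries.derivative ℂ L) = PowerSeries.derivative ℂ L := by
    have e1 := congrArg (PowerSeries.derivative ℂ) hVU
    have e2 := congrArg PowerSeries.evalNegHom hL
    rw [map_mul] at e2
    rw [Derivation.leibniz, derivative_evalNegHom, e2, hL, Derivation.map_one_eq_zero] at e1
    simp only [smul_eq_mul] at e1
    linear_combination -e1 + (PowerSeries.derivative ℂ L -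
      PowerSeries.evalNegHom (PowerSeries.derivative ℂ L)) * hVU
  have hcoeff : ∀ n, Even n → PowerSeries.coeff n L = 0 := by
    intro n hn
    cases n with
    | zero => rw [PowerSeries.coeff_zero_eq_constantCoeff_apply, hL0]
    | succ n =>
      have hodd : Odd n := by
        by_contra h
        exact (Nat.not_even_iff_odd.mpr (Nat.not_odd_iff_even.mp h).add_one) hn
      have := congrArg (PowerSeries.coeff n) heven
      rw [coeff_evalNegHom, hodd.neg_one_pow, PowerSeries.coeff_derivative] at this
      have h2 : PowerSeries.coeff (n + 1) L * ((n : ℂ) + 1) = 0 := by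
        linear_combination (-1 / 2) * this
      exact (mul_eq_zero.mp h2).resolve_right (Nat.cast_add_one_ne_zero n)
  have hL1 : PowerSeries.coeff 1 L = 0 := by
    have := congrArg (PowerSeries.coeff 0) hL
    rw [PowerSeries.coeff_derivative, PowerSeries.coeff_zero_eq_constantCoeff_apply (_ * _),
      map_mul, hS.1, ← PowerSeries.coeff_zero_eq_constantCoeff_apply,
      PowerSeries.coeff_derivative, zero_add, h1] at this
    simpa using this.symm
  refine ⟨fun n => PowerSeries.coeff n L, ?_⟩
  rw [hexp, expOdd]
  congr 1
  ext n
  rw [PowerSeries.coeff_mk]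
  split_ifs with h
  · rfl
  · by_cases hn : Even n
    · exact hcoeff n hn
    · have : n = 1 := by
        have := Nat.not_even_iff_odd.mp hn
        have h3 : ¬ 3 ≤ n := fun h3 => h ⟨this, h3⟩
        obtain ⟨k, rfl⟩ := this
        omega
      rw [this, hL1]

theorem coeff_one_mul_of_mem {S S' : (ℂ⟦X⟧)ˣ} (hS : S ∈ GMinus) (hS' : S' ∈ GMinus) :
    PowerSeries.coeff 1 ((S * S' : (ℂ⟦X⟧)ˣ) : ℂ⟦X⟧) =
      PowerSeries.coeff 1 (S : ℂ⟦X⟧) + PowerSeries.coeff 1 (S' : ℂ⟦X⟧) := by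
  have e : ∀ U ∈ GMinus, PowerSeries.coeff 0 (U : ℂ⟦X⟧) = 1 := fun U hU => by
    rw [PowerSeries.coeff_zero_eq_constantCoeff_apply]
    exact hU.1
  rw [Units.val_mul, PowerSeries.coeff_mul,
    Finset.Nat.sum_antidiagonal_eq_sum_range_succ_mk, Finset.sum_range_succ, Finset.sum_range_one]
  simp only [e S hS, Nat.sub_zero, Nat.sub_self, e S' hS']
  ring

theorem exists_translate_cone {F F' : Potential} (hF : F ∈ GW₀) (hF' : F' ∈ GW₀) :
    ∃ S ∈ GMinus, (∃ a : ℕ → ℂ, (S : ℂ⟦X⟧) = expOdd a) ∧ translate S (cone F) = cone F' := by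
  obtain ⟨S, hS, hS1, hSF⟩ := exists_translate_pointPotential hF
  obtain ⟨S', hS', hS1', hSF'⟩ := exists_translate_pointPotential hF'
  have hinv := GMinus.inv_mem hS
  have hmem := GMinus.mul_mem hS' hinv
  -- The route goes through the point potential. Coefficients at `z⁻¹` add under multiplication in
  -- `GMinus`, so the quotient again has `S₁ = 0`.
  refine ⟨S' * S⁻¹, hmem, exists_eq_expOdd hmem ?_, ?_⟩
  · have h := coeff_one_mul_of_mem hS hinv
    rw [mul_inv_cancel, Units.val_one, PowerSeries.coeff_one, if_neg one_ne_zero, hS1,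
      zero_add] at h
    rw [coeff_one_mul_of_mem hS' hinv, hS1', ← h, add_zero]
  · rw [← hSF, translate_translate, ← Units.val_mul, inv_mul_cancel_right, hSF']

end

end GenusZero

open GenusZero in
theorem mainTheorem4 :
    (∀ S ∈ GMinus, PowerSeries.coeff 1 (S : PowerSeries ℂ) = 0 → ∀ F ∈ GW₀,
      ∃! F' : Potential, F' ∈ GW₀ ∧ translate S (cone F) = cone F') ∧
    pointPotential ∈ GW₀ ∧
    (∀ F ∈ GW₀, ∃ S ∈ GMinus, (∃ a : ℕ → ℂ, (S : PowerSeries ℂ) = expOdd a) ∧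
      translate S (cone pointPotential) = cone F) ∧
    (∀ F ∈ GW₀, ∀ F' ∈ GW₀, ∃ S ∈ GMinus, (∃ a : ℕ → ℂ, (S : PowerSeries ℂ) = expOdd a) ∧
      translate S (cone F) = cone F') :=
  ⟨fun _ hS h1 _ hF => existsUnique_translate_cone hS h1 hF, pointPotential_mem,
    fun _ hF => exists_translate_cone pointPotential_mem hF,
    fun _ hF _ hF' => exists_translate_cone hF hF'⟩
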